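/- Let $n\in\mathbb N$, let $d_1,\dots,d_n>0$, $D=\mathrm{diag}(d_1,\dots,d_n)$, and let $\mu:[-1,0]\to\mathcal L(\mathbb C^n)$ be a function of bounded variation. Put $\mathcal X=L^2([0,1];\mathbb C^n)\cong (L^2[0,1])^n$ and $\mathfrak X=\mathcal X\times L^2([-1,0];\mathcal X)$, and let $$\mathfrak A_m(f,\varphi)=(-D f',\ \varphi'),\qquad D(\mathfrak A_m)=\mathfrak Z:=H^1([0,1];\mathbb C^n)\times W^{1,2}([-1,0];\mathcal X),$$ with weak derivatives. For $(f,\varphi)\in\mathfrak Z$, with continuous representatives, put $$\mathfrak G(f,\varphi)=(f(0),\ \varphi(0)),\qquad \mathfrak M(f,\varphi)=\Big(\int_0^1\int_{-1}^0 d\mu(\theta)\,\varphi(\theta)(x)\,dx,\ f\Big),$$ where the inner integral is the $\mathcal X$-valued Stieltjes integral of the continuous function $\varphi$ against $\mu$, the matrices acting pointwise in $x$. Let $\mathfrak A^{cl}$ be the restriction of $\mathfrak A_m$ to $D(\mathfrak A^{cl})=\{z\in\mathfrak Z:\mathfrak G z=\mathfrak M z\}$. **Proposition.** The operator $\mathfrak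 A^{cl}$ generates a $C_0$-semigroup on $\mathfrak X$. Hence the transport system with distributed delay in the boundary condition, $$\partial_t y+D\,\partial_x y=0,\qquad y(0,t)=\int_0^1\int_{-1}^0 d\mu(\theta)\,y(x,t+\theta)\,dx,\qquad y(\cdot,0)=y_0,\qquad y(\cdot,\theta)=\varphi(\theta)\ (-1\le\theta\le 0),$$ written as $$\dot z(t)=\mathfrak A_m z(t),\qquad \mathfrak G z(t)=\mathfrak M z(t)\quad (t\ge 0),\qquad z(0)=z_0=(y_0,\varphi),$$ is well-posed, in the following sense. The space $D(\mathfrak A^{cl})$ is dense in $\mathfrak X$. For every $z_0=(y_0,\varphi)\in D(\mathfrak A^{cl})$ there is exactly one classical solution $z=(y,v)\in C^1([0,\infty);\mathfrak X)$ with values in $\mathfrak Z$. Its second component is the history of the first: for every $t\ge0$ and almost every $\theta\in[-1,0]$, $v(t)(\theta)=y(t+\theta)$ if $t+\theta\ge0$, and $v(t)(\theta)=\varphi(t+\theta)$ otherwise. For every $\tau\ge0$ there is a constant $C$ such that $\|z(t)\|\le C\|z_0\|$ for all $t\in[0,\tau]$ and every classical solution $z$ with initial value $z_0$. -/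

import Mathlib

open MeasureTheory Set Filter Topology
open scoped ContDiff ENNReal NNReal

namespace DelayTransport
noncomputable section

/-- The space `L²([a,b]; E)`. -/
abbrev L2 (a b : ℝ) (E : Type) [NormedAddCommGroup E] : Type :=
  Lp E 2 (volume.restrict (Icc a b))

/-- Test functions: real smooth functions with compact support inside `(a,b)`. -/
structure IsTest (a b : ℝ) (η : ℝ → ℝ) : Prop where
  smooth : ContDiff ℝ ∞ η
  compact : HasCompactSupport η
  supp : tsupport η ⊆ Ioo a b

theorem L2.integrable {a b : ℝ} {E : Type} [NormedAddCommGroup E] (f : L2 a b E) : IntegrableOn f (Icc a b) :=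
  (Lp.memLp f).integrable (by norm_num)

theorem contRep_unique {a b : ℝ} {E : Type} [NormedAddCommGroup E]
    (hab : a < b) {F G : C(Icc a b, E)}
    (h : ∀ᵐ x ∂volume.restrict (Icc a b), IccExtend hab.le F x = IccExtend hab.le G x) :
    F = G := by
  have := Measure.eqOn_Icc_of_ae_eq volume hab.ne h (F.continuous.Icc_extend').continuousOn
    (G.continuous.Icc_extend').continuousOn
  ext x
  have h2 := this x.2
  rwa [IccExtend_of_mem _ _ x.2, IccExtend_of_mem _ _ x.2] at h2

section Sobolev

variable {a b : ℝ} {E : Type} [NormedAddCommGroup E] [NormedSpace ℂ E]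

/-- `g ∈ L²([a,b]; E)` is the weak derivative of `f ∈ L²([a,b]; E)` on `(a,b)`. -/
def IsWeakDeriv (f g : L2 a b E) : Prop :=
  ∀ η : ℝ → ℝ, IsTest a b η →
    ∫ x in Icc a b, deriv η x • f x = - ∫ x in Icc a b, η x • g x

theorem IsTest.bound {η : ℝ → ℝ} (h : IsTest a b η) : ∃ C, ∀ x, ‖η x‖ ≤ C :=
  h.smooth.continuous.bounded_above_of_compact_support h.compact

theorem IsTest.deriv {η : ℝ → ℝ} (h : IsTest a b η) : IsTest a b (deriv η) where
  smooth := (contDiff_infty_iff_deriv.1 h.smooth).2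
  compact := h.compact.deriv
  supp := (tsupport_deriv_subset ).trans h.supp

theorem IsTest.integrable {η : ℝ → ℝ} (h : IsTest a b η) {f : ℝ → E}
    (hf : IntegrableOn f (Icc a b)) : IntegrableOn (fun x => η x • f x) (Icc a b) := by
  obtain ⟨C, hC⟩ := h.bound
  exact Integrable.bdd_smul (𝕜 := ℝ) hf C h.smooth.continuous.aestronglyMeasurable (ae_of_all _ hC)

theorem IsWeakDeriv.add {f g f' g' : L2 a b E} (h : IsWeakDeriv f g) (h' : IsWeakDeriv f' g') :
    IsWeakDeriv (f + f') (g + g') := by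
  intro η hη
  have e1 : ∫ x in Icc a b, deriv η x • (f + f' : L2 a b E) x
      = ∫ x in Icc a b, (deriv η x • f x + deriv η x • f' x) := by
    refine integral_congr_ae ?_
    filter_upwards [Lp.coeFn_add f f'] with x hx
    rw [hx, Pi.add_apply, smul_add]
  have e2 : ∫ x in Icc a b, η x • (g + g' : L2 a b E) x
      = ∫ x in Icc a b, (η x • g x + η x • g' x) := by
    refine integral_congr_ae ?_
    filter_upwards [Lp.coeFn_add g g'] with x hx
    rw [hx, Pi.add_apply, smul_add]
  rw [e1, e2, integral_add (hη.deriv.integrable f.integrable) (hη.deriv.integrable f'.integrable),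
    integral_add (hη.integrable g.integrable) (hη.integrable g'.integrable), h η hη, h' η hη]
  abel

theorem IsWeakDeriv.smul {f g : L2 a b E} (c : ℂ) (h : IsWeakDeriv f g) :
    IsWeakDeriv (c • f) (c • g) := by
  intro η hη
  have e1 : ∫ x in Icc a b, deriv η x • (c • f : L2 a b E) x
      = ∫ x in Icc a b, c • (deriv η x • f x) := by
    refine integral_congr_ae ?_
    filter_upwards [Lp.coeFn_smul c f] with x hx
    rw [hx, Pi.smul_apply, smul_comm]
  have e2 : ∫ x in Icc a b, η x • (c • g : L2 a b E) x
      = ∫ x in Icc a b, c • (η x • g x) := by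
    refine integral_congr_ae ?_
    filter_upwards [Lp.coeFn_smul c g] with x hx
    rw [hx, Pi.smul_apply, smul_comm]
  rw [e1, e2, integral_smul, integral_smul, h η hη, smul_neg]

theorem isWeakDeriv_zero : IsWeakDeriv (0 : L2 a b E) 0 := by
  simpa using! fun η hη => by
    have : ∀ ζ : ℝ → ℝ, ∫ x in Icc a b, ζ x • (0 : L2 a b E) x = 0 := fun ζ => by
      rw [integral_congr_ae (g := fun _ => (0 : E)), integral_zero]
      filter_upwards [Lp.coeFn_zero E 2 (volume.restrict (Icc a b))] with x hx
      rw [hx]; simp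
    rw [this, this, neg_zero]

theorem ae_zero_of_test [CompleteSpace E] {f : ℝ → E} (hf : IntegrableOn f (Icc a b))
    (h : ∀ η, IsTest a b η → ∫ x in Icc a b, η x • f x = 0) :
    ∀ᵐ x ∂volume.restrict (Icc a b), f x = 0 := by
  have h1 := (isOpen_Ioo (a := a) (b := b)).ae_eq_zero_of_integral_contDiff_smul_eq_zero
    (μ := volume) (f := f) ((hf.mono_set Ioo_subset_Icc_self).locallyIntegrableOn) (by
      intro g hg1 hg2 hg3
      rw [← h g ⟨hg1, hg2, hg3⟩]
      refine (setIntegral_eq_integral_of_forall_compl_eq_zero ?_).symm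
      intro x hx
      rw [image_eq_zero_of_notMem_tsupport fun hh => hx (Ioo_subset_Icc_self (hg3 hh)), zero_smul])
  rw [← restrict_Ioo_eq_restrict_Icc]
  exact (ae_restrict_iff' measurableSet_Ioo).2 h1

/-- Weak derivatives are unique. -/
theorem IsWeakDeriv.unique [CompleteSpace E] {f g g' : L2 a b E} (h : IsWeakDeriv f g)
    (h' : IsWeakDeriv f g') : g = g' := by
  have : ∀ᵐ x ∂volume.restrict (Icc a b), g x - g' x = 0 := by
    refine ae_zero_of_test (g.integrable.sub g'.integrable) fun η hη => ?_
    simp_rw [smul_sub]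
    rw [integral_sub (hη.integrable g.integrable) (hη.integrable g'.integrable)]
    have := (h η hη).symm.trans (h' η hη)
    rw [neg_inj] at this
    rw [this, sub_self]
  ext
  filter_upwards [this] with x hx using sub_eq_zero.1 hx

/-- A function with vanishing weak derivative is almost everywhere constant. -/
theorem ae_const_of_test [CompleteSpace E] (hab : a < b) {f : ℝ → E}
    (hf : IntegrableOn f (Icc a b))
    (h : ∀ η, IsTest a b η → ∫ x in Icc a b, deriv η x • f x = 0) :
    ∃ c : E, ∀ᵐ x ∂volume.restrict (Icc a b), f x = c := by
  let m := (a + b) / 2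
  let B : ContDiffBump m := ⟨(b - a) / 8, (b - a) / 4, by linarith, by linarith⟩
  let ρ : ℝ → ℝ := B.normed volume
  have hρ : IsTest a b ρ := by
    refine ⟨B.contDiff_normed, B.hasCompactSupport_normed, ?_⟩
    rw [B.tsupport_normed_eq, Real.closedBall_eq_Icc]
    intro x hx
    simp only [m, B, mem_Icc, mem_Ioo] at hx ⊢
    constructor <;> linarith [hx.1, hx.2]
  have hρ1 : ∫ x, ρ x = 1 := B.integral_normed
  refine ⟨∫ x in Icc a b, ρ x • f x, ?_⟩
  set c := ∫ x in Icc a b, ρ x • f x with hc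
  have key : ∀ w, IsTest a b w → ∫ x in Icc a b, w x • f x = (∫ x, w x) • c := by
    intro w hw
    set I := ∫ x, w x
    let v : ℝ → ℝ := fun x => w x - I * ρ x
    have hv : ContDiff ℝ ∞ v := hw.smooth.sub (contDiff_const.mul hρ.smooth)
    let η : ℝ → ℝ := fun x => ∫ t in a..x, v t
    have hη' : ∀ x, HasDerivAt η (v x) x := fun x =>
      (hv.continuous.integral_hasStrictDerivAt a x).hasDerivAt
    have hd : deriv η = v := funext fun x => (hη' x).deriv
    have hvint : ∫ x, v x = 0 := by
      have i1 : Integrable w := hw.smooth.continuous.integrable_of_hasCompactSupport hw.compact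
      have i2 : Integrable ρ := hρ.smooth.continuous.integrable_of_hasCompactSupport hρ.compact
      rw [integral_sub i1 (i2.const_mul I), integral_const_mul, hρ1, mul_one, sub_self]
    -- a compact set carrying everything
    obtain ⟨a', b', ha', hb', hab', hK⟩ : ∃ a' b', a < a' ∧ b' < b ∧ a' ≤ b' ∧
        ∀ x, x ∉ Icc a' b' → v x = 0 := by
      have hcomp : IsCompact (tsupport w ∪ tsupport ρ) := hw.compact.union hρ.compact
      have hsub : tsupport w ∪ tsupport ρ ⊆ Ioo a b := union_subset hw.supp hρ.supp
      have hne : (tsupport w ∪ tsupport ρ).Nonempty := by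
        by_contra hne
        rw [not_nonempty_iff_eq_empty, union_empty_iff] at hne
        have : ρ = 0 := tsupport_eq_empty_iff.1 hne.2
        rw [this] at hρ1
        simp at hρ1
      obtain ⟨p, hp, hp'⟩ := hcomp.exists_isLeast hne
      obtain ⟨q, hq, hq'⟩ := hcomp.exists_isGreatest hne
      refine ⟨p, q, (hsub hp).1, (hsub hq).2, hp' hq, fun x hx => ?_⟩
      have hx' : x ∉ tsupport w ∪ tsupport ρ := fun h => hx ⟨hp' h, hq' h⟩
      simp only [mem_union, not_or] at hx'
      simp [v, image_eq_zero_of_notMem_tsupport hx'.1, image_eq_zero_of_notMem_tsupport hx'.2]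
    have hη0 : ∀ x, x ∉ Icc a' b' → η x = 0 := by
      intro x hx
      rcases lt_or_ge x a' with h1 | h1
      · have : ∀ t ∈ uIcc a x, v t = 0 := fun t ht => hK t fun h => by
          have := (mem_uIcc.1 ht)
          rcases this with h2 | h2 <;> linarith [h.1, h2.1, h2.2]
        simp only [η]
        rw [intervalIntegral.integral_congr (g := fun _ => (0:ℝ)) this]
        simp
      · have h2 : b' < x := by
          by_contra h3; exact hx ⟨h1, not_lt.1 h3⟩
        simp only [η]
        rw [intervalIntegral.integral_of_le (by linarith), ← hvint]
        refine setIntegral_eq_integral_of_forall_compl_eq_zero fun t ht => hK t fun h => ht ?_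
        exact ⟨by linarith [h.1], by linarith [h.2]⟩
    have hsupp : tsupport η ⊆ Icc a' b' := by
      refine closure_minimal (fun x hx => ?_) isClosed_Icc
      by_contra h; exact hx (hη0 x h)
    have hηt : IsTest a b η := by
      refine ⟨?_, isCompact_Icc.of_isClosed_subset (isClosed_tsupport _) hsupp,
        hsupp.trans fun x hx => ⟨by linarith [hx.1], by linarith [hx.2]⟩⟩
      exact contDiff_infty_iff_deriv.2 ⟨fun x => (hη' x).differentiableAt, by rw [hd]; exact hv⟩
    have := h η hηt
    rw [hd] at this
    simp only [v, sub_smul, mul_smul] at this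
    have e := integral_sub (hw.integrable hf) ((hρ.integrable hf).smul I)
    simp only [Pi.smul_apply, integral_smul, ← hc] at e
    exact sub_eq_zero.1 (e.symm.trans this)
  have h0 : ∀ᵐ x ∂volume.restrict (Icc a b), f x - c = 0 := by
    have ic : IntegrableOn (fun _ : ℝ => c) (Icc a b) := by simp
    refine ae_zero_of_test (hf.sub ic) fun η hη => ?_
    simp only [smul_sub]
    rw [integral_sub (hη.integrable hf) (hη.integrable ic), key η hη, integral_smul_const,
      setIntegral_eq_integral_of_forall_compl_eq_zero, sub_self]
    intro x hx
    exact image_eq_zero_of_notMem_tsupport fun hh => hx (Ioo_subset_Icc_self (hη.supp hh))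
  filter_upwards [h0] with x hx using sub_eq_zero.1 hx

theorem primitive_weak [CompleteSpace E] (hab : a < b) {g : ℝ → E}
    (hg : IntegrableOn g (Icc a b)) {η : ℝ → ℝ} (hη : IsTest a b η) :
    ∫ x in Icc a b, deriv η x • (∫ t in a..x, g t) = - ∫ x in Icc a b, η x • g x := by
  have hgi : IntervalIntegrable g volume a b :=
    (intervalIntegrable_iff_integrableOn_Icc_of_le hab.le).2 hg
  have hFc : ContinuousOn (fun x => ∫ t in a..x, g t) (Icc a b) := by
    have := intervalIntegral.continuousOn_primitive_interval' hgi left_mem_uIcc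
    rwa [uIcc_of_le hab.le] at this
  have hFi : IntegrableOn (fun x => ∫ t in a..x, g t) (Icc a b) := hFc.integrableOn_Icc
  refine (SeparatingDual.eq_iff_forall_dual_eq (R := ℝ)).2 fun ℓ => ?_
  rw [map_neg, ← ContinuousLinearMap.integral_comp_comm _ (hη.deriv.integrable hFi),
    ← ContinuousLinearMap.integral_comp_comm _ (hη.integrable hg)]
  simp only [map_smul, smul_eq_mul]
  have hℓ : IntervalIntegrable (fun t => ℓ (g t)) volume a b := ⟨ℓ.integrable_comp hgi.1, ℓ.integrable_comp hgi.2⟩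
  have e1 : ∀ x ∈ Icc a b, ℓ (∫ t in a..x, g t) = ∫ t in a..x, ℓ (g t) := by
    intro x hx
    refine (ℓ.intervalIntegral_comp_comm (hgi.mono_set ?_)).symm
    rw [uIcc_of_le hx.1, uIcc_of_le hab.le]; exact Icc_subset_Icc_right hx.2
  rw [setIntegral_congr_fun measurableSet_Icc
    (g := fun x => deriv η x * ∫ t in a..x, ℓ (g t)) (fun x hx => by simp only [e1 x hx])]
  have acη : AbsolutelyContinuousOnInterval η a b :=
    ((hη.smooth.of_le (by simp)).contDiffOn).absolutelyContinuousOnInterval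
  have acF := hℓ.absolutelyContinuousOnInterval_intervalIntegral (c := a) left_mem_uIcc
  have := acF.integral_mul_deriv_eq_deriv_mul acη
  have ηa : η a = 0 := image_eq_zero_of_notMem_tsupport fun hh => (hη.supp hh).1.false
  have ηb : η b = 0 := image_eq_zero_of_notMem_tsupport fun hh => (hη.supp hh).2.false
  rw [ηa, ηb, mul_zero, mul_zero, sub_zero, zero_sub] at this
  rw [integral_Icc_eq_integral_Ioc, integral_Icc_eq_integral_Ioc,
    ← intervalIntegral.integral_of_le hab.le, ← intervalIntegral.integral_of_le hab.le]
  simp_rw [mul_comm (deriv η _)]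
  rw [this, neg_inj]
  refine intervalIntegral.integral_congr_ae ?_
  filter_upwards [hℓ.ae_hasDerivAt_integral] with x hx hx'
  rw [(hx (uIoc_subset_uIcc hx') a left_mem_uIcc).deriv, mul_comm]

/-- A function with a square integrable weak derivative has a continuous representative. -/
theorem IsWeakDeriv.exists_contRep [CompleteSpace E] (hab : a < b) {f g : L2 a b E}
    (h : IsWeakDeriv f g) :
    ∃ F : C(Icc a b, E), ∀ᵐ x ∂volume.restrict (Icc a b), f x = IccExtend hab.le F x := by
  have hgi : IntervalIntegrable g volume a b :=
    (intervalIntegrable_iff_integrableOn_Icc_of_le hab.le).2 g.integrable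
  have hFc : ContinuousOn (fun x => ∫ t in a..x, g t) (Icc a b) := by
    have := intervalIntegral.continuousOn_primitive_interval' hgi left_mem_uIcc
    rwa [uIcc_of_le hab.le] at this
  have hFi : IntegrableOn (fun x => ∫ t in a..x, g t) (Icc a b) := hFc.integrableOn_Icc
  obtain ⟨c, hc⟩ := ae_const_of_test hab (f.integrable.sub hFi) (fun η hη => by
    simp only [Pi.sub_apply, smul_sub]
    rw [integral_sub (hη.deriv.integrable f.integrable) (hη.deriv.integrable hFi),
      primitive_weak hab g.integrable hη, h η hη, sub_self])
  have hcc : ContinuousOn (fun x => c + ∫ t in a..x, g t) (Icc a b) := continuousOn_const.add hFc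
  refine ⟨⟨_, continuousOn_iff_continuous_domRestrict.1 hcc⟩, ?_⟩
  filter_upwards [hc, ae_restrict_mem measurableSet_Icc] with x hx hx'
  rw [ContinuousMap.coe_mk, IccExtend_of_mem _ _ hx', domRestrict_apply]
  rw [← hx]; simp

/-- The Sobolev space `H¹([a,b]; E) = W^{1,2}([a,b]; E)` as a subspace of `L²([a,b]; E)`. -/
def sobolev (a b : ℝ) (E : Type) [NormedAddCommGroup E] [NormedSpace ℂ E] :
    Submodule ℂ (L2 a b E) where
  carrier := {f | ∃ g, IsWeakDeriv f g}
  add_mem' := fun ⟨g, hg⟩ ⟨g', hg'⟩ => ⟨g + g', hg.add hg'⟩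
  zero_mem' := ⟨0, isWeakDeriv_zero⟩
  smul_mem' := fun c _ ⟨g, hg⟩ => ⟨c • g, hg.smul c⟩

/-- The weak derivative `f ↦ f'` from `W^{1,2}([a,b]; E)` to `L²([a,b]; E)`. -/
def weakDeriv (a b : ℝ) (E : Type) [NormedAddCommGroup E] [NormedSpace ℂ E] [CompleteSpace E] :
    sobolev a b E →ₗ[ℂ] L2 a b E where
  toFun f := f.2.choose
  map_add' f f' :=
    (f + f').2.choose_spec.unique (f.2.choose_spec.add f'.2.choose_spec)
  map_smul' c f := (c • f).2.choose_spec.unique (f.2.choose_spec.smul c)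

theorem weakDeriv_spec [CompleteSpace E] (f : sobolev a b E) :
    IsWeakDeriv (f : L2 a b E) (weakDeriv a b E f) := f.2.choose_spec

theorem exists_contRep [CompleteSpace E] (hab : a < b) (f : sobolev a b E) :
    ∃ F : C(Icc a b, E), ∀ᵐ x ∂volume.restrict (Icc a b),
      (f : L2 a b E) x = IccExtend hab.le F x :=
  f.2.choose_spec.exists_contRep hab

/-- The continuous representative on `[a,b]` of an element of `W^{1,2}([a,b]; E)`. -/
def contRep {a b : ℝ} {E : Type} [NormedAddCommGroup E] [NormedSpace ℂ E] [CompleteSpace E]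
    (hab : a < b) : sobolev a b E →ₗ[ℂ] C(Icc a b, E) where
  toFun f := (exists_contRep hab f).choose
  map_add' f f' := contRep_unique hab (by
    filter_upwards [(exists_contRep hab (f + f')).choose_spec, (exists_contRep hab f).choose_spec,
      (exists_contRep hab f').choose_spec, Lp.coeFn_add (f : L2 a b E) (f' : L2 a b E)]
      with x h h1 h2 h3
    rw [← h, Submodule.coe_add, h3, Pi.add_apply, h1, h2]
    rfl)
  map_smul' c f := contRep_unique hab (by
    filter_upwards [(exists_contRep hab (c • f)).choose_spec, (exists_contRep hab f).choose_spec,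
      Lp.coeFn_smul c (f : L2 a b E)] with x h h1 h3
    rw [← h, Submodule.coe_smul, h3, Pi.smul_apply, h1]
    rfl)

theorem contRep_spec [CompleteSpace E] (hab : a < b) (f : sobolev a b E) :
    ∀ᵐ x ∂volume.restrict (Icc a b), (f : L2 a b E) x = IccExtend hab.le (contRep hab f) x :=
  (exists_contRep hab f).choose_spec

end Sobolev

/-- A vector measure with values in a finite-dimensional space has finite total variation;
hence continuous functions on a compact interval are integrable against it. -/
theorem variation_lt_top {X V : Type*} [MeasurableSpace X] [NormedAddCommGroup V]
    [NormedSpace ℝ V] [FiniteDimensional ℝ V] (m : VectorMeasure X V) :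
    IsFiniteMeasure m.variation := by
  let B := Module.finBasis ℝ V
  let ℓ : Fin (Module.finrank ℝ V) → (V →L[ℝ] ℝ) := fun i => LinearMap.toContinuousLinearMap (B.coord i)
  let s : Fin (Module.finrank ℝ V) → SignedMeasure X := fun i =>
    m.mapRange (ℓ i : V →+ ℝ) (ℓ i).continuous
  have hs : ∀ i, (s i).variation univ ≤ 2 * (s i).bound := by
    intro i
    by_contra h
    obtain ⟨t, -, -, ht⟩ := (s i).exists_subset_lt_enorm_apply_of_lt_variation MeasurableSet.univ
      (not_le.1 h)
    refine absurd ht (not_lt.2 ?_)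
    gcongr
    exact VectorMeasure.enorm_apply_le_bound
  have hle : m.variation ≤ ∑ i, ‖B i‖₊ • (s i).variation := by
    refine VectorMeasure.variation_le_of_forall_enorm_le fun A _ => ?_
    have e : m A = ∑ i, (s i A) • B i := (B.sum_repr (m A)).symm
    rw [e]
    refine (enorm_sum_le _ _).trans ?_
    simp only [Measure.coe_finsetSum, Finset.sum_apply, Measure.smul_apply]
    refine Finset.sum_le_sum fun i _ => ?_
    rw [enorm_smul, mul_comm, ENNReal.smul_def, smul_eq_mul]
    exact mul_le_mul' le_rfl (VectorMeasure.enorm_measure_le_variation _ _)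
  refine ⟨(hle univ).trans_lt ?_⟩
  simp only [Measure.coe_finsetSum, Finset.sum_apply, Measure.smul_apply]
  refine ENNReal.sum_lt_top.2 fun i _ => ?_
  rw [ENNReal.smul_def, smul_eq_mul]
  exact ENNReal.mul_lt_top (by simp) ((hs i).trans_lt (ENNReal.mul_lt_top (by simp) (by simp)))

/-- The boundary space `ℂⁿ` with the Euclidean norm. -/
abbrev Cn (n : ℕ) : Type := EuclideanSpace ℂ (Fin n)

/-- The space `L²([0,1]; ℂⁿ) ≅ (L²[0,1])ⁿ` of profiles `x ↦ y(x,t)`. -/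
abbrev Profile (n : ℕ) : Type := L2 0 1 (Cn n)

/-- The space `L²([-1,0]; L²([0,1]; ℂⁿ))` of histories `θ ↦ y(·,t+θ)`. -/
abbrev History (n : ℕ) : Type := L2 (-1) 0 (Profile n)

/-- The state space: pairs (profile, history). -/
abbrev State (n : ℕ) : Type := Profile n × History n

/-- The space of boundary values `ℂⁿ × L²([0,1]; ℂⁿ)`. -/
abbrev BoundarySpace (n : ℕ) : Type := Cn n × Profile n

/-- Closed intervals in `[-1,0]` are compact. -/
instance : CompactIccSpace (Icc (-1 : ℝ) 0) where
  isCompact_Icc := fun {_ _} => isClosed_Icc.isCompact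

/-- The pairing `(f, A) ↦ A f`, where the matrix `A` acts pointwise: `(A f)(x) = A (f x)`. -/
def pairing (n : ℕ) : Profile n →L[ℝ] (Cn n →L[ℂ] Cn n) →L[ℝ] Profile n :=
  (((ContinuousLinearMap.id ℂ (Cn n →L[ℂ] Cn n)).compLpL₂ 2
    (volume.restrict (Icc (0 : ℝ) 1))).flip).bilinearRestrictScalars ℝ

theorem pairing_apply (n : ℕ) (f : Profile n) (A : Cn n →L[ℂ] Cn n) :
    pairing n f A = A.compLp f := rfl

/-- The Stieltjes integral `φ ↦ ∫_{-1}^0 dμ(θ) φ(θ)` of a continuous `L²([0,1]; ℂⁿ)`-valued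
function on `[-1,0]` against the operator-valued function `μ` of bounded variation. Jumps of `μ` at the
end points `-1` and `0` are counted. -/
def stieltjes {n : ℕ} {μ : Icc (-1 : ℝ) 0 → (Cn n →L[ℂ] Cn n)} (hμ : BoundedVariationOn μ univ) :
    C(Icc (-1 : ℝ) 0, Profile n) →ₗ[ℂ] Profile n where
  toFun φ := hμ.vectorMeasure.integral φ (pairing n)
  map_add' φ ψ := by
    have := variation_lt_top hμ.vectorMeasure
    exact VectorMeasure.integral_fun_add
      (φ.continuous.integrable_of_hasCompactSupport (HasCompactSupport.of_compactSpace _))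
      (ψ.continuous.integrable_of_hasCompactSupport (HasCompactSupport.of_compactSpace _))
  map_smul' c φ := by
    have := variation_lt_top hμ.vectorMeasure
    have hφ : Integrable φ hμ.vectorMeasure.variation :=
      φ.continuous.integrable_of_hasCompactSupport (HasCompactSupport.of_compactSpace _)
    let C : Profile n →L[ℝ] Profile n := (c • ContinuousLinearMap.id ℂ (Profile n)).restrictScalars ℝ
    have h1 := VectorMeasure.integral_continuousLinearMap_comp (B := pairing n) (C := C) hφ
    have h2 := VectorMeasure.continuousLinearMap_apply_integral (B := pairing n) (C := C) hφ
    refine h1.trans (Eq.trans ?_ h2.symm)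
    congr 1
    ext1 f
    ext1 A
    exact map_smul (A.compLpL 2 (volume.restrict (Icc (0 : ℝ) 1))) c f

/-- `f ↦ ∫_0^1 f(x) dx`. -/
def spaceIntegral (n : ℕ) : Profile n →ₗ[ℂ] Cn n where
  toFun f := ∫ x in Icc (0 : ℝ) 1, f x
  map_add' f g := by
    rw [← integral_add f.integrable g.integrable]
    exact integral_congr_ae (Lp.coeFn_add f g)
  map_smul' c f := by
    rw [RingHom.id_apply, ← integral_smul]
    exact integral_congr_ae (Lp.coeFn_smul c f)

/-- The maximal domain `H¹([0,1]; ℂⁿ) × W^{1,2}([-1,0]; L²([0,1]; ℂⁿ))`. -/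
abbrev maxDomain (n : ℕ) : Submodule ℂ (State n) :=
  (sobolev 0 1 (Cn n)).prod (sobolev (-1) 0 (Profile n))

/-- First component of an element of the maximal domain. -/
def profilePart (n : ℕ) : maxDomain n →ₗ[ℂ] sobolev 0 1 (Cn n) where
  toFun z := ⟨z.1.1, z.2.1⟩
  map_add' _ _ := rfl
  map_smul' _ _ := rfl

/-- Second component of an element of the maximal domain. -/
def historyPart (n : ℕ) : maxDomain n →ₗ[ℂ] sobolev (-1) 0 (Profile n) where
  toFun z := ⟨z.1.2, z.2.2⟩
  map_add' _ _ := rfl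
  map_smul' _ _ := rfl

/-- The matrix `D = diag(d₁, …, dₙ)`. -/
def velocity {n : ℕ} (d : Fin n → ℝ) : Cn n →L[ℂ] Cn n :=
  Matrix.toEuclideanCLM (𝕜 := ℂ) (Matrix.diagonal fun i => (d i : ℂ))

/-- `f ↦ -D f'`. -/
def transportOp {n : ℕ} (d : Fin n → ℝ) : sobolev 0 1 (Cn n) →ₗ[ℂ] Profile n :=
  -(((velocity d).compLpL 2 (volume.restrict (Icc (0 : ℝ) 1))).toLinearMap ∘ₗ weakDeriv 0 1 (Cn n))

/-- The maximal operator `(f, φ) ↦ (-D f', φ')`. -/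
def maxOp {n : ℕ} (d : Fin n → ℝ) : maxDomain n →ₗ[ℂ] State n :=
  (transportOp d ∘ₗ profilePart n).prod (weakDeriv (-1) 0 (Profile n) ∘ₗ historyPart n)

/-- Point evaluation of the continuous representative. -/
def evalAt {a b : ℝ} {E : Type} [NormedAddCommGroup E] [NormedSpace ℂ E] [CompleteSpace E]
    (hab : a < b) (x : Icc a b) : sobolev a b E →ₗ[ℂ] E where
  toFun f := contRep hab f x
  map_add' f g := by rw [map_add]; rfl
  map_smul' c f := by rw [map_smul]; rfl

/-- The boundary operator `(f, φ) ↦ (f(0), φ(0))`. -/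
def traceOp (n : ℕ) : maxDomain n →ₗ[ℂ] BoundarySpace n :=
  (evalAt zero_lt_one ⟨0, left_mem_Icc.2 zero_le_one⟩ ∘ₗ profilePart n).prod
    (evalAt neg_one_lt_zero ⟨0, right_mem_Icc.2 neg_one_lt_zero.le⟩ ∘ₗ historyPart n)

/-- The delay operator `φ ↦ ∫_0^1 ∫_{-1}^0 dμ(θ) φ(θ)(x) dx`. -/
def delayOp {n : ℕ} {μ : Icc (-1 : ℝ) 0 → (Cn n →L[ℂ] Cn n)} (hμ : BoundedVariationOn μ univ) :
    sobolev (-1) 0 (Profile n) →ₗ[ℂ] Cn n :=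
  spaceIntegral n ∘ₗ stieltjes hμ ∘ₗ contRep neg_one_lt_zero

/-- The boundary feedback `(f, φ) ↦ (∫_0^1 ∫_{-1}^0 dμ(θ) φ(θ)(x) dx, f)`. -/
def feedbackOp {n : ℕ} {μ : Icc (-1 : ℝ) 0 → (Cn n →L[ℂ] Cn n)} (hμ : BoundedVariationOn μ univ) :
    maxDomain n →ₗ[ℂ] BoundarySpace n :=
  (delayOp hμ ∘ₗ historyPart n).prod ((sobolev 0 1 (Cn n)).subtype ∘ₗ profilePart n)

/-- The closed-loop operator: the restriction of the maximal operator to those `(f, φ)` in the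
maximal domain whose boundary values equal the boundary feedback. -/
def closedLoop {n : ℕ} (d : Fin n → ℝ) {μ : Icc (-1 : ℝ) 0 → (Cn n →L[ℂ] Cn n)}
    (hμ : BoundedVariationOn μ univ) : State n →ₗ.[ℂ] State n where
  domain := (LinearMap.eqLocus (traceOp n) (feedbackOp hμ)).map (maxDomain n).subtype
  toFun := maxOp d ∘ₗ Submodule.inclusion (Submodule.map_subtype_le _ _)

/-- `(T(t))_{t ≥ 0}` is a strongly continuous semigroup; values at `t < 0` play no role. -/
structure IsC0Semigroup {X : Type*} [NormedAddCommGroup X] [NormedSpace ℂ X]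
    (T : ℝ → X →L[ℂ] X) : Prop where
  zero : T 0 = 1
  add : ∀ s t, 0 ≤ s → 0 ≤ t → T (s + t) = T s * T t
  continuousOn : ∀ x, ContinuousOn (fun t => T t x) (Ici 0)

/-- `A` is the generator of `T`: the domain consists of all `x` for which the right derivative at `0`
of the orbit `t ↦ T(t)x` exists, and `A x` is this derivative. -/
def IsGenerator {X : Type*} [NormedAddCommGroup X] [NormedSpace ℂ X]
    (A : X →ₗ.[ℂ] X) (T : ℝ → X →L[ℂ] X) : Prop :=
  ∀ x y : X, (x, y) ∈ A.graph ↔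
    Tendsto (fun h : ℝ => (h : ℂ)⁻¹ • (T h x - x)) (𝓝[>] 0) (𝓝 y)

/-- `A` generates a strongly continuous semigroup. -/
def GeneratesC0Semigroup {X : Type*} [NormedAddCommGroup X] [NormedSpace ℂ X]
    (A : X →ₗ.[ℂ] X) : Prop :=
  ∃ T : ℝ → X →L[ℂ] X, IsC0Semigroup T ∧ IsGenerator A T

/-- Classical solutions on `[0,∞)`, continuously differentiable in the state space, of
`z'(t) = maxOp (z t)`, `traceOp (z t) = feedbackOp (z t)`, `z(0) = z₀`.
With `z(t) = (y(t), v(t))` this is the delay system `∂ₜ y + D ∂ₓ y = 0`,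
`y(0,t) = ∫_0^1 ∫_{-1}^0 dμ(θ) v(t)(x,θ) dx`, where `∂ₜ v = ∂_θ v` and `v(t)(·,0) = y(t)`. -/
structure IsClassicalSolution {n : ℕ} (d : Fin n → ℝ) {μ : Icc (-1 : ℝ) 0 → (Cn n →L[ℂ] Cn n)}
    (hμ : BoundedVariationOn μ univ) (z₀ : State n) (z : ℝ → maxDomain n) : Prop where
  initial : (z 0 : State n) = z₀
  evolution : ∀ t, 0 ≤ t →
    HasDerivWithinAt (fun s => (z s : State n)) (maxOp d (z t)) (Ici 0) t
  continuous_deriv : ContinuousOn (fun t => maxOp d (z t)) (Ici 0)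
  boundary : ∀ t, 0 ≤ t → traceOp n (z t) = feedbackOp hμ (z t)

/-- The second component of `z(t) = (y(t), v(t))` is the history segment of `y`:
`v(t)(θ) = y(t+θ)`, with the prescribed initial history at negative times. -/
def IsHistoryOf {n : ℕ} (z₀ : State n) (z : ℝ → maxDomain n) : Prop :=
  ∀ t, 0 ≤ t → ∀ᵐ θ ∂volume.restrict (Icc (-1 : ℝ) 0),
    (z t : State n).2 θ = if 0 ≤ t + θ then (z (t + θ) : State n).1 else z₀.2 (t + θ)

/-- Well-posedness of the delay system: dense set of initial data, existence of a classical solution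
whose second component is the history of the first one, uniqueness, and continuous dependence on
the initial data, uniformly on compact time intervals. -/
structure IsWellPosed {n : ℕ} (d : Fin n → ℝ) {μ : Icc (-1 : ℝ) 0 → (Cn n →L[ℂ] Cn n)}
    (hμ : BoundedVariationOn μ univ) : Prop where
  dense : Dense ((closedLoop d hμ).domain : Set (State n))
  existence : ∀ z₀ ∈ (closedLoop d hμ).domain,
    ∃ z : ℝ → maxDomain n, IsClassicalSolution d hμ z₀ z ∧ IsHistoryOf z₀ z
  uniqueness : ∀ (z₀ : State n) (z w : ℝ → maxDomain n), IsClassicalSolution d hμ z₀ z →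
    IsClassicalSolution d hμ z₀ w → ∀ t, 0 ≤ t → z t = w t
  continuous_dependence : ∀ τ : ℝ, 0 ≤ τ → ∃ C : ℝ, ∀ (z₀ : State n) (z : ℝ → maxDomain n),
    IsClassicalSolution d hμ z₀ z → ∀ t ∈ Icc 0 τ, ‖(z t : State n)‖ ≤ C * ‖z₀‖

end
end DelayTransport

/-!
The closed-loop operator is quasi-dissipative in an equivalent Hilbert norm, so that the
Lumer–Phillips theorem applies.

Let `ν` be the total variation of `μ`. The delay operator satisfies
`|Φ φ|² ≤ K ∫ |φ(θ)|² dν(θ)` (`exists_delay_bound`), and this is not bounded in terms of the `L²` norm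
of the history. On the state space use the norm
`∫ |D^{-1/2} f|² dx + ∫ (1 + K ν([-1,θ])) |φ(θ)|² dθ`.
For `z = (f, φ)` with `f(0) = Φ φ` and `φ(0) = f`, integration by parts in `x` bounds the contribution
of the profile to `Re ⟪A z, z⟫` by `|f(0)|² / 2 ≤ K/2 ∫ |φ|² dν`. Integration by parts in `θ`
(Fubini, `integral_weight_mul`) gives for the history a multiple of `|φ(0)|² = |f|²` minus
`K/2 ∫ |φ|² dν`. The two integrals against `ν` cancel and `Re ⟪A z, z⟫ ≤ κ |z|²` is left
(`exists_dissipative_equiv`).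

For the range condition, the equation `c z - A z = y` is solved explicitly for every prescribed
inflow `f(0) = w` (`exists_maxOp_resolvent`). What remains is a linear system for `w` in `ℂⁿ`, which
is injective for `c > κ` by dissipativity, hence solvable (`exists_closedLoop_resolvent`).

The Hille–Yosida theorem is proved through Yosida approximation (`exists_contraction_semigroup`), and
carried over to quasi-dissipative operators by shifting and by a change of norm
(`exists_semigroup_of_dissipative`). Orbits in the domain are the classical solutions. Uniqueness and
continuous dependence follow from the energy estimate `norm_le_of_dissipative`, which holds for every
classical solution. That the second component is the history of the first one is seen by pairing it
with a test function that moves along the characteristics `θ + t = const` (`shift_eq_history`).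
-/

namespace DelayTransport
open scoped BoundedContinuousFunction

noncomputable section

/-! ### Exponentials of bounded operators -/

section Exponential

variable {𝔸 : Type*} [NormedRing 𝔸] [NormedAlgebra ℝ 𝔸]

theorem norm_exp_le_of_norm_one_le (h1 : ‖(1 : 𝔸)‖ ≤ 1) (a : 𝔸) :
    ‖NormedSpace.exp a‖ ≤ Real.exp ‖a‖ := by
  rw [NormedSpace.exp_eq_tsum ℝ, Real.exp_eq_exp_ℝ]
  have hs : HasSum (fun n : ℕ => (Nat.factorial n : ℝ)⁻¹ • ‖a‖ ^ n) (NormedSpace.exp ‖a‖) :=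
    NormedSpace.exp_series_hasSum_exp' ‖a‖
  refine tsum_of_norm_bounded hs fun k => ?_
  rw [norm_smul, smul_eq_mul, Real.norm_of_nonneg (by positivity)]
  gcongr
  cases k with
  | zero => simpa using h1
  | succ k => exact norm_pow_le' a k.succ_pos

/-- The Yosida approximant `c² R - c` generates a contraction semigroup as soon as
`‖R‖ ≤ 1 / c`, because `exp (t (c² R - c)) = exp (- t c) exp (t c² R)`. -/
theorem norm_exp_yosida_le [CompleteSpace 𝔸] (h1 : ‖(1 : 𝔸)‖ ≤ 1) {c t : ℝ} (hc : 0 < c) (ht : 0 ≤ t) {R : 𝔸}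
    (hR : ‖R‖ ≤ c⁻¹) : ‖NormedSpace.exp (t • (c ^ 2 • R - c • (1 : 𝔸)))‖ ≤ 1 := by
  let _ : NormedAlgebra ℚ 𝔸 := NormedAlgebra.restrictScalars ℚ ℝ 𝔸
  have hcomm : Commute ((t * c ^ 2) • R) (algebraMap ℝ 𝔸 (-(t * c))) :=
    (Algebra.commutes _ _).symm
  have e : t • (c ^ 2 • R - c • (1 : 𝔸)) = (t * c ^ 2) • R + algebraMap ℝ 𝔸 (-(t * c)) := by
    rw [Algebra.algebraMap_eq_smul_one]; module
  rw [e, NormedSpace.exp_add_of_commute hcomm, ← NormedSpace.algebraMap_exp_comm,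
    Algebra.algebraMap_eq_smul_one, mul_smul_comm, mul_one, norm_smul, ← Real.exp_eq_exp_ℝ,
    Real.norm_of_nonneg (Real.exp_pos _).le]
  calc Real.exp (-(t * c)) * ‖NormedSpace.exp ((t * c ^ 2) • R)‖
      ≤ Real.exp (-(t * c)) * Real.exp (t * c) := by
        gcongr
        refine (norm_exp_le_of_norm_one_le h1 _).trans (Real.exp_le_exp.2 ?_)
        rw [norm_smul, Real.norm_of_nonneg (by positivity)]
        calc t * c ^ 2 * ‖R‖ ≤ t * c ^ 2 * c⁻¹ := by gcongr
          _ = t * c := by field_simp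
    _ = 1 := by rw [← Real.exp_add]; simp

end Exponential

/-! ### The Hille–Yosida theorem -/

section HilleYosida

variable {E : Type*} [NormedAddCommGroup E] [NormedSpace ℂ E]

theorem exp_smul_hasDerivAt [CompleteSpace E] (a : E →L[ℂ] E) (x : E) (t : ℝ) :
    HasDerivAt (fun s : ℝ => NormedSpace.exp (s • a) x) (NormedSpace.exp (t • a) (a x)) t := by
  have := hasDerivAt_exp_smul_const (𝕂 := ℝ) a t
  exact (((ContinuousLinearMap.apply ℂ E x).restrictScalars ℝ).hasFDerivAt.comp_hasDerivAt t this)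

/-- Two commuting contraction semigroups with bounded generators differ by at most `t ‖a x - b x‖`:
integrate the derivative of `s ↦ e^{(t-s)b} e^{sa} x`. -/
theorem norm_exp_smul_apply_sub_le [CompleteSpace E] {a b : E →L[ℂ] E} (hab : Commute a b)
    (ha : ∀ t : ℝ, 0 ≤ t → ‖NormedSpace.exp (t • a)‖ ≤ 1)
    (hb : ∀ t : ℝ, 0 ≤ t → ‖NormedSpace.exp (t • b)‖ ≤ 1) (x : E) {t : ℝ} (ht : 0 ≤ t) :
    ‖NormedSpace.exp (t • a) x - NormedSpace.exp (t • b) x‖ ≤ ‖a x - b x‖ * t := by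
  let g : ℝ → E := fun s => NormedSpace.exp ((t - s) • b) (NormedSpace.exp (s • a) x)
  have hg : ∀ s, HasDerivAt g (NormedSpace.exp ((t - s) • b)
      (NormedSpace.exp (s • a) (a x - b x))) s := by
    intro s
    have h1 := (hasDerivAt_exp_smul_const (𝕂 := ℝ) b (t - s)).scomp s
      ((hasDerivAt_id s).const_sub t)
    have h2 := exp_smul_hasDerivAt a x s
    have h1' : HasDerivAt (fun s : ℝ => (NormedSpace.exp ((t - s) • b)).restrictScalars ℝ)
        (((-1 : ℝ) • (NormedSpace.exp ((t - s) • b) * b)).restrictScalars ℝ) s :=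
      (ContinuousLinearMap.restrictScalarsL ℂ E E ℝ ℝ).hasFDerivAt.comp_hasDerivAt s h1
    have h3 := h1'.clm_apply h2
    have hc : b (NormedSpace.exp (s • a) x) = NormedSpace.exp (s • a) (b x) := by
      have : Commute b (NormedSpace.exp (s • a)) := ((hab.symm).smul_right s).exp_right
      exact congrArg (fun L : E →L[ℂ] E => L x) this.eq
    have e : NormedSpace.exp ((t - s) • b) (NormedSpace.exp (s • a) (a x - b x))
        = (-1 : ℝ) • NormedSpace.exp ((t - s) • b) (b (NormedSpace.exp (s • a) x))
          + NormedSpace.exp ((t - s) • b) (NormedSpace.exp (s • a) (a x)) := by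
      rw [hc, map_sub, map_sub]; module
    rw [e]
    exact h3
  have := norm_image_sub_le_of_norm_deriv_le_segment' (f := g) (a := 0) (b := t)
    (C := ‖a x - b x‖) (fun s _ => (hg s).hasDerivWithinAt) (fun s hs => by
      refine ((NormedSpace.exp ((t - s) • b)).le_opNorm _).trans ?_
      refine (mul_le_of_le_one_left (norm_nonneg _) (hb _ (by linarith [hs.2]))).trans ?_
      refine ((NormedSpace.exp (s • a)).le_opNorm _).trans ?_
      exact mul_le_of_le_one_left (norm_nonneg _) (ha _ hs.1)) t ⟨ht, le_rfl⟩
  simpa [g] using this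

/-- The limit in the definition of the generator is the right derivative of the orbit at `0`. -/
theorem tendsto_orbit_iff {T : ℝ → E →L[ℂ] E} (hT : T 0 = 1) (x y : E) :
    Tendsto (fun h : ℝ => (h : ℂ)⁻¹ • (T h x - x)) (𝓝[>] 0) (𝓝 y) ↔
      HasDerivWithinAt (fun h => T h x) y (Ioi 0) 0 := by
  rw [hasDerivWithinAt_iff_tendsto_slope' self_notMem_Ioi]
  refine tendsto_congr fun h => ?_
  rw [slope_def_module, sub_zero, hT, ← Complex.ofReal_inv, Complex.coe_smul]
  rfl

/-- The resolvents `(c - A)⁻¹`, `c > 0`, as bounded operators. -/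
theorem exists_resolvent (A : E →ₗ.[ℂ] E)
    (hdiss : ∀ c : ℝ, 0 < c → ∀ x : A.domain, c * ‖(x : E)‖ ≤ ‖(c : ℂ) • (x : E) - A x‖)
    (hsurj : ∀ c : ℝ, 0 < c → ∀ y, ∃ x : A.domain, (c : ℂ) • (x : E) - A x = y)
    {c : ℝ} (hc : 0 < c) :
    ∃ R : E →L[ℂ] E, ‖R‖ ≤ c⁻¹ ∧ (∀ x : A.domain, R ((c : ℂ) • (x : E) - A x) = x) ∧
      ∀ y, ∃ x : A.domain, (x : E) = R y ∧ (c : ℂ) • (x : E) - A x = y := by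
  let B : A.domain →ₗ[ℂ] E := (c : ℂ) • A.domain.subtype - A.toFun
  have hBapp : ∀ x : A.domain, B x = (c : ℂ) • (x : E) - A x := fun x => rfl
  have hinj : Function.Injective B := by
    rw [injective_iff_map_eq_zero]
    intro x hx
    have := hdiss c hc x
    rw [← hBapp, hx, norm_zero] at this
    have h0 : ‖(x : E)‖ ≤ 0 := by
      by_contra h
      push Not at h
      nlinarith [mul_pos hc h]
    exact Subtype.ext (norm_le_zero_iff.1 h0)
  let e := LinearEquiv.ofBijective B ⟨hinj, fun y => hsurj c hc y⟩
  have hbd : ∀ y, ‖(A.domain.subtype ∘ₗ e.symm.toLinearMap) y‖ ≤ c⁻¹ * ‖y‖ := by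
    intro y
    have h1 := hdiss c hc (e.symm y)
    have h2 : (c : ℂ) • ((e.symm y : A.domain) : E) - A (e.symm y) = y := e.apply_symm_apply y
    rw [h2] at h1
    rw [inv_mul_eq_div, le_div_iff₀ hc, mul_comm]
    exact h1
  refine ⟨LinearMap.mkContinuous _ c⁻¹ hbd,
    LinearMap.mkContinuous_norm_le _ (by positivity) _, fun x => ?_, fun y => ?_⟩
  · exact congrArg Subtype.val (e.symm_apply_apply x)
  · exact ⟨e.symm y, rfl, e.apply_symm_apply y⟩

/-- **Hille–Yosida theorem** for contraction semigroups: a densely defined operator `A` with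
`c ‖x‖ ≤ ‖c x - A x‖` and `c - A` surjective for all `c > 0` generates a contraction semigroup.
Moreover the orbits of points of the domain are differentiable. -/
theorem exists_contraction_semigroup [CompleteSpace E] (A : E →ₗ.[ℂ] E) (hdense : Dense (A.domain : Set E))
    (hdiss : ∀ c : ℝ, 0 < c → ∀ x : A.domain, c * ‖(x : E)‖ ≤ ‖(c : ℂ) • (x : E) - A x‖)
    (hsurj : ∀ c : ℝ, 0 < c → ∀ y, ∃ x : A.domain, (c : ℂ) • (x : E) - A x = y) :
    ∃ T : ℝ → E →L[ℂ] E, IsC0Semigroup T ∧ IsGenerator A T ∧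
      ∀ x : A.domain, ∀ t, 0 ≤ t →
        HasDerivWithinAt (fun s => T s x) (T t (A x)) (Ici 0) t := by
  choose R hRnorm hRleft hRright using fun c : {c : ℝ // 0 < c} => exists_resolvent A hdiss hsurj c.2
  have hone : ‖(1 : E →L[ℂ] E)‖ ≤ 1 := ContinuousLinearMap.norm_id_le
  -- the resolvent identity; resolvents commute
  have hres : ∀ (c e : {c : ℝ // 0 < c}) (y : E),
      R c y - R e y = ((e : ℂ) - c) • R e (R c y) := by
    intro c e y
    obtain ⟨x, hx, hxy⟩ := hRright c y
    have h1 := hRleft e x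
    have h2 : (e : ℂ) • (x : E) - A x = ((e : ℂ) - c) • (x : E) + y := by rw [← hxy]; module
    rw [h2, map_add, map_smul, hx] at h1
    rw [sub_eq_iff_eq_add, h1]
  have hcomm : ∀ c e : {c : ℝ // 0 < c}, Commute (R c) (R e) := by
    intro c e
    ext y
    by_cases h : (e : ℂ) = c
    · have : e = c := Subtype.ext (by exact_mod_cast h)
      rw [this]
    · have h1 := hres c e y
      have h2 := hres e c y
      have h3 : ((e : ℂ) - c) • (R c (R e y) - R e (R c y)) = 0 := by
        rw [smul_sub, ← h1, ← neg_sub (c : ℂ) (e : ℂ), neg_smul, ← h2]; abel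
      exact sub_eq_zero.1 ((smul_eq_zero.1 h3).resolve_left (sub_ne_zero.2 h))
  -- the Yosida approximants, along the integers
  let p : ℕ → {c : ℝ // 0 < c} := fun k => ⟨(k : ℝ) + 1, by positivity⟩
  let Y : ℕ → E →L[ℂ] E := fun k => (p k : ℝ) ^ 2 • R (p k) - (p k : ℝ) • (1 : E →L[ℂ] E)
  have hYcomm : ∀ j k, Commute (Y j) (Y k) := fun j k =>
    ((((hcomm (p j) (p k)).smul_left _).smul_right _).sub_right
      ((Commute.one_right _).smul_right _)).sub_left
      (((Commute.one_left _).smul_left _))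
  let U : ℕ → ℝ → E →L[ℂ] E := fun k t => NormedSpace.exp (t • Y k)
  have hU1 : ∀ k t, 0 ≤ t → ‖U k t‖ ≤ 1 := fun k t ht =>
    norm_exp_yosida_le hone (p k).2 ht (hRnorm _)
  have hUle : ∀ k t, 0 ≤ t → ∀ x, ‖U k t x‖ ≤ ‖x‖ := fun k t ht x =>
    ((U k t).le_opNorm x).trans (mul_le_of_le_one_left (norm_nonneg _) (hU1 k t ht))
  have hpinv : Tendsto (fun k => (p k : ℝ)⁻¹) atTop (𝓝 0) := by
    have := tendsto_one_div_add_atTop_nhds_zero_nat (𝕜 := ℝ)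
    simpa [p] using this
  -- `c R(c) x → x`
  have hcRle : ∀ k x, ‖(p k : ℝ) • R (p k) x‖ ≤ ‖x‖ := by
    intro k x
    rw [norm_smul, Real.norm_of_nonneg (p k).2.le]
    calc (p k : ℝ) * ‖R (p k) x‖ ≤ (p k : ℝ) * ((p k : ℝ)⁻¹ * ‖x‖) := by
          gcongr
          exact ((R (p k)).le_opNorm x).trans (by gcongr; exact hRnorm _)
      _ = ‖x‖ := by rw [← mul_assoc, mul_inv_cancel₀ (p k).2.ne', one_mul]
  have hAR : ∀ k (x : A.domain), R (p k) (A x) = (p k : ℝ) • R (p k) x - x := by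
    intro k x
    have := hRleft (p k) x
    rw [map_sub, map_smul] at this
    rw [← Complex.coe_smul, eq_sub_iff_add_eq, ← eq_sub_iff_add_eq', this]
  have hcR : ∀ x, Tendsto (fun k => (p k : ℝ) • R (p k) x) atTop (𝓝 x) := by
    intro x
    rw [Metric.tendsto_atTop]
    intro ε hε
    obtain ⟨w, hwA, hw⟩ := Metric.dense_iff.1 hdense x (ε / 3) (by positivity)
    have h1 : Tendsto (fun k => (p k : ℝ)⁻¹ * ‖A ⟨w, hw⟩‖) atTop (𝓝 0) := by
      simpa using hpinv.mul_const ‖A ⟨w, hw⟩‖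
    obtain ⟨N, hN⟩ := Metric.tendsto_atTop.1 h1 (ε / 3) (by positivity)
    refine ⟨N, fun k hk => ?_⟩
    have h2 : ‖(p k : ℝ) • R (p k) w - w‖ < ε / 3 := by
      rw [← hAR k ⟨w, hw⟩]
      refine (((R (p k)).le_opNorm _).trans (mul_le_mul_of_nonneg_right (hRnorm _)
        (norm_nonneg _))).trans_lt ?_
      have := hN k hk
      rw [Real.dist_eq, sub_zero] at this
      exact (le_abs_self _).trans_lt this
    have h3 : ‖(p k : ℝ) • R (p k) (x - w)‖ < ε / 3 := by
      refine (hcRle k _).trans_lt ?_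
      rw [← dist_eq_norm, dist_comm]; exact hwA
    have h4 : ‖w - x‖ < ε / 3 := by rw [← dist_eq_norm]; exact hwA
    have e : (p k : ℝ) • R (p k) x - x
        = (p k : ℝ) • R (p k) (x - w) + ((p k : ℝ) • R (p k) w - w) + (w - x) := by
      rw [map_sub, smul_sub]; abel
    rw [dist_eq_norm, e]
    refine (norm_add₃_le).trans_lt ?_
    linarith
  have hYA : ∀ x : A.domain, Tendsto (fun k => Y k x) atTop (𝓝 (A x)) := by
    intro x
    refine (hcR (A x)).congr fun k => ?_
    rw [hAR]
    simp [Y, smul_sub, smul_smul, sq]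
  -- the semigroup is the limit of the exponentials
  have hdiff : ∀ x t, 0 ≤ t → ∀ j k, ‖U j t x - U k t x‖ ≤ ‖Y j x - Y k x‖ * t := fun x t ht j k =>
    norm_exp_smul_apply_sub_le (hYcomm j k) (fun s hs => hU1 j s hs) (fun s hs => hU1 k s hs) x ht
  have hcau : ∀ t, 0 ≤ t → ∀ x, CauchySeq fun k => U k t x := by
    intro t ht x
    rw [Metric.cauchySeq_iff]
    intro ε hε
    obtain ⟨w, hwA, hw⟩ := Metric.dense_iff.1 hdense x (ε / 3) (by positivity)
    have hY := (hYA ⟨w, hw⟩).cauchySeq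
    obtain ⟨N, hN⟩ := Metric.cauchySeq_iff.1 hY (ε / (3 * (t + 1))) (by positivity)
    refine ⟨N, fun j hj k hk => ?_⟩
    have h2 : ‖U j t w - U k t w‖ < ε / 3 := by
      have := hN j hj k hk
      rw [dist_eq_norm] at this
      calc ‖U j t w - U k t w‖ ≤ ‖Y j w - Y k w‖ * t := hdiff w t ht j k
        _ ≤ ‖Y j w - Y k w‖ * (t + 1) := by gcongr; linarith
        _ < ε / (3 * (t + 1)) * (t + 1) := by gcongr
        _ = ε / 3 := by field_simp
    have hxw : ‖x - w‖ < ε / 3 := by rw [← dist_eq_norm, dist_comm]; exact hwA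
    have h3 := (hUle j t ht (x - w)).trans_lt hxw
    have h4 := (hUle k t ht (x - w)).trans_lt hxw
    have e : U j t x - U k t x = U j t (x - w) + (U j t w - U k t w) - U k t (x - w) := by
      rw [map_sub, map_sub]; abel
    rw [dist_eq_norm, e]
    refine (norm_sub_le _ _).trans_lt ?_
    have := norm_add_le (U j t (x - w)) (U j t w - U k t w)
    linarith
  have hlim : ∀ t : ℝ, ∃ S : E →L[ℂ] E, 0 ≤ t →
      (∀ x, ‖S x‖ ≤ ‖x‖) ∧ ∀ x, Tendsto (fun k => U k t x) atTop (𝓝 (S x)) := by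
    intro t
    by_cases ht : 0 ≤ t
    · choose S hS using fun x => cauchySeq_tendsto_of_complete (hcau t ht x)
      let S' : E →ₗ[ℂ] E := linearMapOfTendsto (f := fun x => S x)
        (g := fun k => ((U k t : E →L[ℂ] E) : E →ₗ[ℂ] E)) (l := atTop) (tendsto_pi_nhds.2 hS)
      have hb : ∀ x, ‖S' x‖ ≤ 1 * ‖x‖ := fun x => by
        rw [one_mul]
        exact le_of_tendsto (hS x).norm (Eventually.of_forall fun k => hUle k t ht x)
      refine ⟨S'.mkContinuous 1 hb, fun _ => ⟨fun x => ?_, hS⟩⟩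
      simpa using hb x
    · exact ⟨0, fun h => absurd h ht⟩
  choose T hT using hlim
  have hTle : ∀ t, 0 ≤ t → ∀ x, ‖T t x‖ ≤ ‖x‖ := fun t ht => (hT t ht).1
  have hTU : ∀ t, 0 ≤ t → ∀ x, Tendsto (fun k => U k t x) atTop (𝓝 (T t x)) :=
    fun t ht => (hT t ht).2
  have hmove : ∀ t, 0 ≤ t → ∀ (y : ℕ → E) (x : E), Tendsto y atTop (𝓝 x) →
      Tendsto (fun k => U k t (y k)) atTop (𝓝 (T t x)) := by
    intro t ht y x hy
    have h1 : Tendsto (fun k => U k t (y k - x)) atTop (𝓝 0) := by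
      refine squeeze_zero_norm (fun k => hUle k t ht _) ?_
      have := (hy.sub_const x).norm
      simpa using this
    have := h1.add (hTU t ht x)
    simpa using this
  have hU0 : ∀ k, U k 0 = 1 := fun k => by simp [U]
  have hUadd : ∀ k s t, U k (s + t) = U k s * U k t := by
    intro k s t
    let _ : NormedAlgebra ℚ (E →L[ℂ] E) := NormedAlgebra.restrictScalars ℚ ℂ (E →L[ℂ] E)
    simp only [U, add_smul]
    exact NormedSpace.exp_add_of_commute (((Commute.refl _).smul_left _).smul_right _)
  have hUderiv : ∀ k x t, HasDerivAt (fun s => U k s x) (U k t (Y k x)) t := fun k x t =>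
    exp_smul_hasDerivAt (Y k) x t
  have hzero : T 0 = 1 := by
    ext x
    refine tendsto_nhds_unique (hTU 0 le_rfl x) ?_
    simp [hU0]
  have hadd : ∀ s t, 0 ≤ s → 0 ≤ t → T (s + t) = T s * T t := by
    intro s t hs ht
    ext x
    refine tendsto_nhds_unique (hTU (s + t) (add_nonneg hs ht) x) ?_
    have := hmove s hs _ _ (hTU t ht x)
    simpa [hUadd] using this
  have hlip : ∀ x : A.domain, ∀ s t, 0 ≤ s → s ≤ t → ‖T t x - T s x‖ ≤ ‖A x‖ * (t - s) := by
    intro x s t hs hst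
    refine le_of_tendsto_of_tendsto' ((hTU t (hs.trans hst) x).sub (hTU s hs x)).norm
      ((hYA x).norm.mul_const (t - s)) fun k => ?_
    exact norm_image_sub_le_of_norm_deriv_le_segment' (f := fun r => U k r x) (a := s) (b := t)
      (C := ‖Y k x‖) (fun r _ => (hUderiv k x r).hasDerivWithinAt)
      (fun r hr => hUle k r (hs.trans hr.1) _) t ⟨hst, le_rfl⟩
  have hcontD : ∀ x : A.domain, ContinuousOn (fun t => T t x) (Ici 0) := by
    intro x
    have : LipschitzOnWith ⟨‖A x‖, norm_nonneg _⟩ (fun t => T t x) (Ici 0) := by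
      refine LipschitzOnWith.of_dist_le_mul fun t ht s hs => ?_
      rw [dist_eq_norm, Real.dist_eq]
      rcases le_total s t with h | h
      · rw [abs_of_nonneg (sub_nonneg.2 h)]; exact hlip x s t hs h
      · rw [abs_of_nonpos (sub_nonpos.2 h), neg_sub, norm_sub_rev]; exact hlip x t s ht h
    exact this.continuousOn
  have hcont : ∀ x, ContinuousOn (fun t => T t x) (Ici 0) := by
    intro x
    refine continuousOn_of_uniform_approx_of_continuousOn fun u hu => ?_
    obtain ⟨ε, hε, hu⟩ := Metric.mem_uniformity_dist.1 hu
    obtain ⟨w, hwA, hw⟩ := Metric.dense_iff.1 hdense x ε hε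
    refine ⟨fun t => T t w, hcontD ⟨w, hw⟩, fun t ht => hu ?_⟩
    rw [dist_eq_norm, ← map_sub]
    refine (hTle t ht _).trans_lt ?_
    rw [← dist_eq_norm, dist_comm]; exact hwA
  -- the integral equation, and differentiability of orbits
  have hint : ∀ x : A.domain, ∀ t, 0 ≤ t → T t x - x = ∫ s in (0 : ℝ)..t, T s (A x) := by
    intro x t ht
    have h1 : ∀ k, ∫ s in (0 : ℝ)..t, U k s (Y k x) = U k t x - x := by
      intro k
      have hc : Continuous fun s => U k s (Y k x) :=
        continuous_iff_continuousAt.2 fun s => (hUderiv k (Y k x) s).continuousAt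
      rw [intervalIntegral.integral_eq_sub_of_hasDerivAt (fun s _ => hUderiv k x s)
        (hc.intervalIntegrable _ _), hU0]
      rfl
    obtain ⟨C, hC⟩ := (hYA x).norm.bddAbove_range
    have h2 : Tendsto (fun k => ∫ s in (0 : ℝ)..t, U k s (Y k x)) atTop
        (𝓝 (∫ s in (0 : ℝ)..t, T s (A x))) := by
      refine intervalIntegral.tendsto_integral_filter_of_dominated_convergence (fun _ => C) ?_ ?_ ?_ ?_
      · refine Eventually.of_forall fun k => ?_
        exact (continuous_iff_continuousAt.2
          fun s => (hUderiv k (Y k x) s).continuousAt).aestronglyMeasurable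
      · refine Eventually.of_forall fun k => ae_of_all _ fun s hs => ?_
        rw [uIoc_of_le ht] at hs
        exact (hUle k s hs.1.le _).trans (hC ⟨k, rfl⟩)
      · simp
      · refine ae_of_all _ fun s hs => ?_
        rw [uIoc_of_le ht] at hs
        exact hmove s hs.1.le _ _ (hYA x)
    refine tendsto_nhds_unique ?_ h2
    simp_rw [h1]
    exact (hTU t ht x).sub_const _
  have hderiv : ∀ x : A.domain, ∀ t, 0 ≤ t →
      HasDerivWithinAt (fun s => T s x) (T t (A x)) (Ici 0) t := by
    intro x t ht
    have hc : Continuous fun s : ℝ => T (max s 0) (A x) :=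
      (hcont (A x)).comp_continuous (by fun_prop) fun s => mem_Ici.2 (le_max_right _ _)
    have h1 := ((hc.integral_hasStrictDerivAt 0 t).hasDerivAt.const_add (x : E)).hasDerivWithinAt
      (s := Ici 0)
    rw [max_eq_left ht] at h1
    have h2 : ∀ s ∈ Ici (0 : ℝ), T s x = x + ∫ r in (0 : ℝ)..s, T (max r 0) (A x) := by
      intro s hs
      rw [← sub_eq_iff_eq_add', hint x s hs]
      refine intervalIntegral.integral_congr fun r hr => ?_
      rw [uIcc_of_le hs] at hr
      simp only [max_eq_left hr.1]
    exact h1.congr h2 (h2 t ht)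
  refine ⟨T, ⟨hzero, hadd, hcont⟩, ?_, hderiv⟩
  -- the generator extends `A`
  have hext : ∀ x : A.domain,
      Tendsto (fun h : ℝ => (h : ℂ)⁻¹ • (T h x - x)) (𝓝[>] 0) (𝓝 (A x)) := by
    intro x
    have h1 := (hderiv x 0 le_rfl).mono Ioi_subset_Ici_self
    rw [hzero] at h1
    exact (tendsto_orbit_iff hzero _ _).2 h1
  intro x y
  constructor
  · intro hxy
    obtain ⟨x', hx', rfl⟩ := (LinearPMap.mem_graph_iff A).1 hxy
    simp only at hx'
    rw [← hx']
    exact hext x'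
  · intro hxy
    -- with `x' = R(1)(x - y)` in the domain of `A`, the orbit of `w = x - x'` has derivative `w`
    -- at `0`; a contraction semigroup allows this only for `w = 0`
    let c : {c : ℝ // 0 < c} := ⟨1, one_pos⟩
    obtain ⟨x', hx', hx'y⟩ := hRright c (x - y)
    simp only [c, Complex.ofReal_one, one_smul] at hx'y
    have hw : Tendsto (fun h : ℝ => (h : ℂ)⁻¹ • (T h (x - x') - (x - x'))) (𝓝[>] 0)
        (𝓝 (x - x')) := by
      have := hxy.sub (hext x')
      have e : y - A x' = x - x' := by
        rw [sub_eq_sub_iff_add_eq_add] at hx'y ⊢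
        rw [add_comm, hx'y]
      rw [e] at this
      refine this.congr fun h => ?_
      rw [map_sub, ← smul_sub]; congr 1; abel
    have hw0 : ‖x - (x' : E)‖ ≤ 0 := by
      have h1 : Tendsto (fun h : ℝ => ‖(h : ℂ)⁻¹ • (T h (x - x') - (x - x')) - (x - x')‖)
          (𝓝[>] 0) (𝓝 0) := by
        simpa using (hw.sub_const (x - (x' : E))).norm
      refine ge_of_tendsto h1 ?_
      filter_upwards [self_mem_nhdsWithin] with h (hh : 0 < h)
      set w := x - (x' : E)
      have h2 : (h : ℂ) • ((h : ℂ)⁻¹ • (T h w - w) - w) = T h w - ((1 + h : ℝ) : ℂ) • w := by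
        rw [smul_sub, smul_inv_smul₀ (by exact_mod_cast hh.ne')]; push_cast; module
      have h3 : h * ‖(h : ℂ)⁻¹ • (T h w - w) - w‖ = ‖T h w - ((1 + h : ℝ) : ℂ) • w‖ := by
        rw [← h2, norm_smul, Complex.norm_real, Real.norm_of_nonneg hh.le]
      have h4 : (1 + h) * ‖w‖ ≤ ‖T h w‖ + ‖T h w - ((1 + h : ℝ) : ℂ) • w‖ := by
        have := norm_sub_le (T h w) (T h w - ((1 + h : ℝ) : ℂ) • w)
        rwa [sub_sub_cancel, norm_smul, Complex.norm_real,
          Real.norm_of_nonneg (by positivity)] at this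
      have h5 := hTle h hh.le w
      have : h * ‖w‖ ≤ h * ‖(h : ℂ)⁻¹ • (T h w - w) - w‖ := by rw [h3]; linarith
      exact le_of_mul_le_mul_left this hh
    have hxx : x = x' := sub_eq_zero.1 (norm_le_zero_iff.1 hw0)
    refine (LinearPMap.mem_graph_iff A).2 ⟨x', hxx.symm, ?_⟩
    rw [← hxx] at hx'y
    exact sub_right_injective hx'y

end HilleYosida

/-! ### The Lumer–Phillips theorem -/

section LumerPhillips

variable {X H : Type*} [NormedAddCommGroup X] [NormedSpace ℂ X]
  [NormedAddCommGroup H] [InnerProductSpace ℂ H]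

/-- A quasi-dissipative estimate for `A`, measured in the Hilbert norm `‖J ·‖`, gives the resolvent
estimate. -/
theorem resolvent_estimate (J : X ≃L[ℂ] H) {x y : X} {κ : ℝ}
    (h : (inner ℂ (J y) (J x)).re ≤ κ * ‖J x‖ ^ 2) (c : ℝ) :
    (c - κ) * ‖J x‖ ≤ ‖(c : ℂ) • J x - J y‖ := by
  have h1 : (inner ℂ ((c : ℂ) • J x - J y) (J x)).re
      = c * ‖J x‖ ^ 2 - (inner ℂ (J y) (J x)).re := by
    rw [inner_sub_left, inner_smul_left, inner_self_eq_norm_sq_to_K, Complex.conj_ofReal,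
      Complex.sub_re, Complex.re_ofReal_mul]
    norm_cast
  have h2 : (inner ℂ ((c : ℂ) • J x - J y) (J x)).re ≤ ‖(c : ℂ) • J x - J y‖ * ‖J x‖ :=
    (Complex.re_le_norm _).trans (norm_inner_le_norm _ _)
  rcases (norm_nonneg (J x)).eq_or_lt with h0 | h0
  · rw [← h0, mul_zero]; exact norm_nonneg _
  · refine le_of_mul_le_mul_right ?_ h0
    nlinarith

/-- **Lumer–Phillips theorem**, for an operator that is quasi-dissipative with respect to the
equivalent Hilbert norm `‖J ·‖`. -/
theorem exists_semigroup_of_dissipative [CompleteSpace H] (J : X ≃L[ℂ] H) (A : X →ₗ.[ℂ] X) (κ : ℝ)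
    (hdiss : ∀ x : A.domain, (inner ℂ (J (A x)) (J x)).re ≤ κ * ‖J x‖ ^ 2)
    (hsurj : ∀ c : ℝ, κ < c → ∀ y, ∃ x : A.domain, (c : ℂ) • (x : X) - A x = y) :
    Dense (A.domain : Set X) ∧ ∃ T : ℝ → X →L[ℂ] X, IsC0Semigroup T ∧ IsGenerator A T ∧
      ∀ x : A.domain, ∀ t, 0 ≤ t →
        HasDerivWithinAt (fun s => T s x) (T t (A x)) (Ici 0) t := by
  -- the operator `J (A - κ) J⁻¹` on `H` is dissipative
  let B : H →ₗ.[ℂ] H :=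
    { domain := A.domain.comap (J.symm : H →ₗ[ℂ] X)
      toFun := (J : X →ₗ[ℂ] H) ∘ₗ A.toFun ∘ₗ
        ((J.symm : H →ₗ[ℂ] X).restrict (p := A.domain.comap (J.symm : H →ₗ[ℂ] X)) fun _ h => h)
        - (κ : ℂ) • Submodule.subtype _ }
  have hBdom : ∀ u : H, u ∈ B.domain ↔ J.symm u ∈ A.domain := fun u => Iff.rfl
  have hB : ∀ (u : B.domain), B u = J (A ⟨J.symm u, u.2⟩) - (κ : ℂ) • (u : H) := fun u => rfl
  have hBdense : Dense (B.domain : Set H) := by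
    rw [Submodule.dense_iff_topologicalClosure_eq_top, Submodule.topologicalClosure_eq_top_iff,
      Submodule.eq_bot_iff]
    intro y hy
    obtain ⟨x, hx⟩ := hsurj (κ + 1) (by linarith) (J.symm y)
    have hxy : ((κ + 1 : ℝ) : ℂ) • J x - J (A x) = y := by
      rw [← map_smul, ← map_sub, hx, J.apply_symm_apply]
    have h0 : inner ℂ (J x) y = 0 :=
      hy (J x) ((hBdom _).2 (by rw [J.symm_apply_apply]; exact x.2))
    have h1 : (inner ℂ (J x) y).re
        = (κ + 1) * ‖J x‖ ^ 2 - (inner ℂ (J (A x)) (J x)).re := by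
      rw [← hxy, inner_sub_right, inner_smul_right, inner_self_eq_norm_sq_to_K, Complex.sub_re,
        Complex.re_ofReal_mul, ← inner_conj_symm (J x) (J (A x)), Complex.conj_re]
      norm_cast
    rw [h0, Complex.zero_re] at h1
    have h2 : ‖J (x : X)‖ ^ 2 ≤ 0 := by linarith [hdiss x]
    have h3 : J (x : X) = 0 := by
      rw [← norm_eq_zero]; exact pow_eq_zero_iff two_ne_zero |>.1 (le_antisymm h2 (sq_nonneg _))
    have h4 : x = 0 := Subtype.ext (J.map_eq_zero_iff.1 h3)
    rw [← hxy, h4]; simp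
  have hAdense : Dense (A.domain : Set X) := by
    have h1 : Dense (J.symm '' (B.domain : Set H)) :=
      J.symm.surjective.denseRange.dense_image J.symm.continuous hBdense
    refine h1.mono ?_
    rintro _ ⟨u, hu, rfl⟩
    exact hu
  obtain ⟨S, hS, hSgen, hSderiv⟩ := exists_contraction_semigroup B hBdense
    (fun c hc u => by
      have := resolvent_estimate J (hdiss ⟨J.symm u, u.2⟩) (c + κ)
      simp only [add_sub_cancel_right, J.apply_symm_apply] at this
      refine this.trans_eq ?_
      rw [hB]; congr 1; push_cast; module)
    (fun c hc y => by
      obtain ⟨x, hx⟩ := hsurj (c + κ) (by linarith) (J.symm y)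
      refine ⟨⟨J x, (hBdom _).2 (by rw [J.symm_apply_apply]; exact x.2)⟩, ?_⟩
      rw [hB]
      simp only [J.symm_apply_apply, Subtype.coe_eta]
      have := congrArg J hx
      rw [J.apply_symm_apply, map_sub, map_smul] at this
      rw [← this]; push_cast; module)
  let e : ℝ → ℝ := fun t => Real.exp (κ * t)
  have he : ∀ t, HasDerivAt e (κ * e t) t := fun t => by
    simpa [e, mul_comm] using ((hasDerivAt_id t).const_mul κ).exp
  let T : ℝ → X →L[ℂ] X := fun t => e t • ((J.symm : H →L[ℂ] X) ∘L S t ∘L (J : X →L[ℂ] H))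
  have hTapp : ∀ t x, T t x = e t • J.symm (S t (J x)) := fun t x => rfl
  have hT0 : T 0 = 1 := by
    ext x
    simp [hTapp, e, hS.zero]
  have hJs : ∀ (f : ℝ → H) (f' : H) (s : Set ℝ) (t : ℝ), HasDerivWithinAt f f' s t →
      HasDerivWithinAt (fun r => J.symm (f r)) (J.symm f') s t := fun f f' s t h =>
    ((J.symm : H →L[ℂ] X).restrictScalars ℝ).hasFDerivAt.comp_hasDerivWithinAt t h
  have hJ : ∀ (f : ℝ → X) (f' : X) (s : Set ℝ) (t : ℝ), HasDerivWithinAt f f' s t →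
      HasDerivWithinAt (fun r => J (f r)) (J f') s t := fun f f' s t h =>
    ((J : X →L[ℂ] H).restrictScalars ℝ).hasFDerivAt.comp_hasDerivWithinAt t h
  refine ⟨hAdense, T, ⟨hT0, ?_, ?_⟩, ?_, ?_⟩
  · intro s t hs ht
    ext x
    simp only [hTapp, hS.add s t hs ht, mul_apply_eq_comp]
    rw [← Complex.coe_smul (e t), map_smul, map_smul, map_smul, J.apply_symm_apply,
      Complex.coe_smul, smul_smul]
    simp only [e]
    rw [← Real.exp_add, mul_add]
  · intro x
    have hec : Continuous e := by fun_prop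
    exact hec.continuousOn.smul (J.symm.continuous.comp_continuousOn
      (hS.continuousOn _))
  · intro x y
    have h1 : (x, y) ∈ A.graph ↔ (J x, J y - (κ : ℂ) • J x) ∈ B.graph := by
      rw [LinearPMap.mem_graph_iff, LinearPMap.mem_graph_iff]
      constructor
      · rintro ⟨x', hx', hy'⟩
        simp only at hx' hy'
        refine ⟨⟨J x', (hBdom _).2 (by rw [J.symm_apply_apply]; exact x'.2)⟩, by rw [← hx'], ?_⟩
        rw [hB]
        simp only [J.symm_apply_apply, Subtype.coe_eta, hy']
        rw [hx']
      · rintro ⟨u, hu, hu'⟩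
        simp only at hu hu'
        refine ⟨⟨J.symm u, u.2⟩, by simp [hu], ?_⟩
        rw [hB, ← hu] at hu'
        exact J.injective (sub_left_injective hu')
    rw [h1, hSgen, tendsto_orbit_iff hS.zero, tendsto_orbit_iff hT0]
    constructor
    · intro h
      have := (he 0).hasDerivWithinAt.smul (hJs _ _ _ _ h)
      refine this.congr_deriv ?_
      rw [map_sub, map_smul, J.symm_apply_apply]
      simp [e, hS.zero]
    · intro h
      have he' : HasDerivAt (fun t => Real.exp (-(κ * t))) (-κ) 0 := by
        simpa using (((hasDerivAt_id (0:ℝ)).const_mul κ).neg).exp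
      have h2 := he'.hasDerivWithinAt.smul (hJ _ _ _ _ h)
      have h3 : ∀ t, Real.exp (-(κ * t)) • J (T t x) = S t (J x) := by
        intro t
        rw [hTapp, ← Complex.coe_smul (e t), map_smul, J.apply_symm_apply, Complex.coe_smul,
          smul_smul]
        simp only [e]
        rw [← Real.exp_add, neg_add_cancel, Real.exp_zero, one_smul]
      refine (h2.congr_deriv ?_).congr (fun t _ => (h3 t).symm) (h3 0).symm
      simp [hT0, sub_eq_add_neg]
  · intro x t ht
    have hx : J x ∈ B.domain := (hBdom _).2 (by rw [J.symm_apply_apply]; exact x.2)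
    have h1 := (he t).hasDerivWithinAt.smul (hJs _ _ _ _ (hSderiv ⟨J x, hx⟩ t ht))
    refine h1.congr_deriv ?_
    rw [hB, hTapp]
    simp only [J.symm_apply_apply, Subtype.coe_eta, map_sub, map_smul, smul_sub]
    rw [mul_comm, mul_smul, Complex.coe_smul]
    abel

/-- Gronwall estimate for the trajectories of a quasi-dissipative operator. -/
theorem norm_le_of_dissipative (J : X ≃L[ℂ] H) {κ : ℝ} {z z' : ℝ → X}
    (hz : ∀ t, 0 ≤ t → HasDerivWithinAt z (z' t) (Ici 0) t)
    (hdiss : ∀ t, 0 ≤ t → (inner ℂ (J (z' t)) (J (z t))).re ≤ κ * ‖J (z t)‖ ^ 2)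
    {t : ℝ} (ht : 0 ≤ t) : ‖J (z t)‖ ≤ Real.exp (κ * t) * ‖J (z 0)‖ := by
  let u : ℝ → ℝ := fun t => Real.exp (-(2 * κ * t)) * ‖J (z t)‖ ^ 2
  have hu : ∀ t, 0 ≤ t → HasDerivWithinAt u (Real.exp (-(2 * κ * t)) *
      (2 * (inner ℂ (J (z' t)) (J (z t))).re - 2 * κ * ‖J (z t)‖ ^ 2)) (Ici 0) t := by
    intro t ht
    have h1 : HasDerivWithinAt (fun r => J (z r)) (J (z' t)) (Ici 0) t :=
      ((J : X →L[ℂ] H).restrictScalars ℝ).hasFDerivAt.comp_hasDerivWithinAt t (hz t ht)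
    have h2 := Complex.reCLM.hasFDerivAt.comp_hasDerivWithinAt t (h1.inner ℂ h1)
    have h3 : HasDerivWithinAt (fun r => ‖J (z r)‖ ^ 2) (2 * (inner ℂ (J (z' t)) (J (z t))).re)
        (Ici 0) t := by
      refine (h2.congr_deriv ?_).congr (fun r _ => ?_) ?_
      · rw [map_add, Complex.reCLM_apply, Complex.reCLM_apply, ← inner_conj_symm (J (z t)),
          Complex.conj_re]; ring
      · exact (inner_self_eq_norm_sq (𝕜 := ℂ) _).symm
      · exact (inner_self_eq_norm_sq (𝕜 := ℂ) _).symm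
    have h4 : HasDerivAt (fun r => Real.exp (-(2 * κ * r)))
        (Real.exp (-(2 * κ * t)) * (-(2 * κ))) t := by
      simpa using (((hasDerivAt_id t).const_mul (2 * κ)).neg).exp
    refine (h4.hasDerivWithinAt.mul h3).congr_deriv ?_
    ring
  have hanti : AntitoneOn u (Ici 0) := by
    refine antitoneOn_of_deriv_nonpos (convex_Ici 0) (fun s hs => (hu s hs).continuousWithinAt)
      (fun s hs => ?_) (fun s hs => ?_)
    · rw [interior_Ici] at hs
      exact ((hu s hs.le).hasDerivAt (Ici_mem_nhds hs)).differentiableAt.differentiableWithinAt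
    · rw [interior_Ici] at hs
      rw [((hu s hs.le).hasDerivAt (Ici_mem_nhds hs)).deriv]
      exact mul_nonpos_of_nonneg_of_nonpos (Real.exp_pos _).le (by linarith [hdiss s hs.le])
  have h0 := hanti (mem_Ici.2 le_rfl) (mem_Ici.2 ht) ht
  simp only [u, mul_zero, neg_zero, Real.exp_zero, one_mul] at h0
  refine abs_le_of_sq_le_sq' ?_ (by positivity) |>.2
  rw [mul_pow, ← Real.exp_nat_mul]
  calc ‖J (z t)‖ ^ 2
      = Real.exp (2 * κ * t) * (Real.exp (-(2 * κ * t)) * ‖J (z t)‖ ^ 2) := by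
        rw [← mul_assoc, ← Real.exp_add]; simp
    _ ≤ Real.exp (2 * κ * t) * ‖J (z 0)‖ ^ 2 := by gcongr
    _ = _ := by push_cast; ring_nf

end LumerPhillips

/-! ### Weak derivatives -/

section WeakDerivative

variable {a b : ℝ} {E : Type} [NormedAddCommGroup E]

theorem memLp_of_continuousOn {F : ℝ → E} (hF : ContinuousOn F (Icc a b)) :
    MemLp F 2 (volume.restrict (Icc a b)) := by
  obtain ⟨C, hC⟩ := isCompact_Icc.exists_bound_of_continuousOn hF
  exact MemLp.of_bound hF.integrableOn_Icc.aestronglyMeasurable C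
    ((ae_restrict_iff' measurableSet_Icc).2 (ae_of_all _ hC))

variable [NormedSpace ℂ E]

theorem IsTest.mul {η e : ℝ → ℝ} (hη : IsTest a b η) (he : ContDiff ℝ ∞ e) :
    IsTest a b (fun x => η x * e x) where
  smooth := hη.smooth.mul he
  compact := hη.compact.mul_right
  supp := (tsupport_mul_subset_left).trans hη.supp

theorem IsTest.apply_left {η : ℝ → ℝ} (hη : IsTest a b η) : η a = 0 :=
  image_eq_zero_of_notMem_tsupport fun h => (hη.supp h).1.false

theorem IsTest.apply_right {η : ℝ → ℝ} (hη : IsTest a b η) : η b = 0 :=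
  image_eq_zero_of_notMem_tsupport fun h => (hη.supp h).2.false

/-- `g` is the weak derivative of `f` on `(a,b)`, for integrable functions on the line that are only
relevant on `[a,b]`. -/
structure HasWeakDeriv (a b : ℝ) (f g : ℝ → E) : Prop where
  left : IntegrableOn f (Icc a b)
  right : IntegrableOn g (Icc a b)
  test : ∀ η : ℝ → ℝ, IsTest a b η →
    ∫ x in Icc a b, deriv η x • f x = - ∫ x in Icc a b, η x • g x

theorem IsWeakDeriv.hasWeakDeriv {f g : L2 a b E} (h : IsWeakDeriv f g) : HasWeakDeriv a b f g :=
  ⟨f.integrable, g.integrable, h⟩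

namespace HasWeakDeriv

variable {f g f' g' : ℝ → E}

theorem congr_ae (h : HasWeakDeriv a b f g) (hf : f =ᵐ[volume.restrict (Icc a b)] f')
    (hg : g =ᵐ[volume.restrict (Icc a b)] g') : HasWeakDeriv a b f' g' where
  left := h.left.congr hf
  right := h.right.congr hg
  test η hη := by
    have e1 : ∫ x in Icc a b, deriv η x • f' x = ∫ x in Icc a b, deriv η x • f x :=
      integral_congr_ae (hf.mono fun x hx => by simp only [hx])
    have e2 : ∫ x in Icc a b, η x • g' x = ∫ x in Icc a b, η x • g x :=
      integral_congr_ae (hg.mono fun x hx => by simp only [hx])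
    rw [e1, e2, h.test η hη]

theorem add (h : HasWeakDeriv a b f g) (h' : HasWeakDeriv a b f' g') :
    HasWeakDeriv a b (fun x => f x + f' x) (fun x => g x + g' x) where
  left := h.left.add h'.left
  right := h.right.add h'.right
  test η hη := by
    simp only [smul_add]
    rw [integral_add (hη.deriv.integrable h.left) (hη.deriv.integrable h'.left),
      integral_add (hη.integrable h.right) (hη.integrable h'.right), h.test η hη, h'.test η hη]
    abel

theorem zero : HasWeakDeriv a b (fun _ => (0 : E)) (fun _ => 0) where
  left := integrableOn_zero
  right := integrableOn_zero
  test η hη := by simp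

theorem sum {ι : Type*} {s : Finset ι} {f g : ι → ℝ → E}
    (h : ∀ i ∈ s, HasWeakDeriv a b (f i) (g i)) :
    HasWeakDeriv a b (fun x => ∑ i ∈ s, f i x) (fun x => ∑ i ∈ s, g i x) := by
  classical
  induction s using Finset.induction_on with
  | empty => simpa using zero
  | insert i s hi ih =>
    simp only [Finset.sum_insert hi]
    exact (h i (Finset.mem_insert_self _ _)).add (ih fun j hj => h j (Finset.mem_insert_of_mem hj))

theorem clm {F : Type} [NormedAddCommGroup F] [NormedSpace ℂ F] [CompleteSpace E] [CompleteSpace F]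
    (L : E →L[ℂ] F) (h : HasWeakDeriv a b f g) :
    HasWeakDeriv a b (fun x => L (f x)) (fun x => L (g x)) where
  left := L.integrable_comp h.left
  right := L.integrable_comp h.right
  test η hη := by
    have key : ∀ (ζ : ℝ → ℝ) (k : ℝ → E), IntegrableOn (fun x => ζ x • k x) (Icc a b) →
        ∫ x in Icc a b, ζ x • L (k x) = L (∫ x in Icc a b, ζ x • k x) := by
      intro ζ k hk
      rw [← L.integral_comp_comm hk]
      refine integral_congr_ae (ae_of_all _ fun x => ?_)
      simp only
      rw [← Complex.coe_smul, ← Complex.coe_smul, map_smul]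
    rw [key _ _ (hη.deriv.integrable h.left), key _ _ (hη.integrable h.right), h.test η hη, map_neg]

/-- Product rule with a smooth scalar function: `η e` is a test function whenever `η` is. -/
theorem smul (h : HasWeakDeriv a b f g) {e : ℝ → ℝ} (he : ContDiff ℝ ∞ e) :
    HasWeakDeriv a b (fun x => e x • f x) (fun x => deriv e x • f x + e x • g x) := by
  have hint : ∀ {e : ℝ → ℝ} {k : ℝ → E}, Continuous e → IntegrableOn k (Icc a b) →
      IntegrableOn (fun x => e x • k x) (Icc a b) := fun {e k} he hk =>
    hk.continuousOn_smul he.continuousOn isCompact_Icc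
  have hde : Continuous (deriv e) := he.continuous_deriv (by simp)
  refine ⟨hint he.continuous h.left, (hint hde h.left).add (hint he.continuous h.right),
    fun η hη => ?_⟩
  have hd : ∀ x, deriv (fun x => η x * e x) x = deriv η x * e x + η x * deriv e x := fun x =>
    deriv_fun_mul (hη.smooth.differentiable (by simp) x) (he.differentiable (by simp) x)
  have h1 := h.test _ (hη.mul he)
  simp only [hd, add_smul, mul_smul] at h1
  have i1 := hη.deriv.integrable (hint he.continuous h.left)
  have i2 := hη.integrable (hint hde h.left)
  have i3 := hη.integrable (hint he.continuous h.right)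
  simp only [smul_add]
  rw [integral_add i2 i3, neg_add, ← h1, integral_add i1 i2]
  abel

variable [CompleteSpace E]

theorem const (hab : a < b) (c : E) : HasWeakDeriv a b (fun _ => c) (fun _ => 0) where
  left := by simp
  right := integrableOn_zero
  test η hη := by
    have h1 : ∫ x in Icc a b, deriv η x = 0 := by
      rw [integral_Icc_eq_integral_Ioc, ← intervalIntegral.integral_of_le hab.le,
        intervalIntegral.integral_deriv_eq_sub
          (fun x _ => hη.smooth.differentiable (by simp) x)
          ((hη.deriv.smooth.continuous).intervalIntegrable _ _), hη.apply_left, hη.apply_right,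
        sub_zero]
    rw [integral_smul_const, h1]; simp

theorem primitive (hab : a < b) (hg : IntegrableOn g (Icc a b)) (c : E) :
    HasWeakDeriv a b (fun x => c + ∫ t in a..x, g t) g := by
  have hgi : IntervalIntegrable g volume a b :=
    (intervalIntegrable_iff_integrableOn_Icc_of_le hab.le).2 hg
  have hFc : ContinuousOn (fun x => ∫ t in a..x, g t) (Icc a b) := by
    have := intervalIntegral.continuousOn_primitive_interval' hgi left_mem_uIcc
    rwa [uIcc_of_le hab.le] at this
  have h1 : HasWeakDeriv a b (fun x => ∫ t in a..x, g t) g :=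
    ⟨hFc.integrableOn_Icc, hg, fun η hη => primitive_weak hab hg hη⟩
  simpa using (const hab c).add h1

theorem eq_add_integral (hab : a < b) (h : HasWeakDeriv a b f g) (hf : ContinuousOn f (Icc a b))
    {x : ℝ} (hx : x ∈ Icc a b) : f x = f a + ∫ t in a..x, g t := by
  have hp := primitive hab h.right 0
  simp only [zero_add] at hp
  obtain ⟨c, hc⟩ := ae_const_of_test hab (h.left.sub hp.left) (fun η hη => by
    simp only [Pi.sub_apply, smul_sub]
    rw [integral_sub (hη.deriv.integrable h.left) (hη.deriv.integrable hp.left),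
      h.test η hη, hp.test η hη, sub_self])
  have hgi : IntervalIntegrable g volume a b :=
    (intervalIntegrable_iff_integrableOn_Icc_of_le hab.le).2 h.right
  have hFc : ContinuousOn (fun x => ∫ t in a..x, g t) (Icc a b) := by
    have := intervalIntegral.continuousOn_primitive_interval' hgi left_mem_uIcc
    rwa [uIcc_of_le hab.le] at this
  have := Measure.eqOn_Icc_of_ae_eq volume hab.ne hc (hf.sub hFc) continuousOn_const
  have h1 := this hx
  have h2 := this (left_mem_Icc.2 hab.le)
  simp only [Pi.sub_apply, intervalIntegral.integral_same, sub_zero] at h1 h2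
  rw [h2, ← h1]; abel

theorem integral_eq_sub (hab : a < b) (h : HasWeakDeriv a b f g) (hf : ContinuousOn f (Icc a b)) :
    ∫ x in Icc a b, g x = f b - f a := by
  rw [h.eq_add_integral hab hf (right_mem_Icc.2 hab.le), integral_Icc_eq_integral_Ioc,
    ← intervalIntegral.integral_of_le hab.le]
  abel

end HasWeakDeriv

theorem contRep_hasWeakDeriv [CompleteSpace E] (hab : a < b) (f : sobolev a b E) :
    HasWeakDeriv a b (IccExtend hab.le (contRep hab f)) (weakDeriv a b E f) :=
  (weakDeriv_spec f).hasWeakDeriv.congr_ae (contRep_spec hab f) (ae_eq_refl _)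

/-- A continuous function with a square integrable weak derivative is the continuous representative
of an element of the Sobolev space. -/
theorem HasWeakDeriv.exists_sobolev [CompleteSpace E] (hab : a < b) {F g : ℝ → E}
    (h : HasWeakDeriv a b F g) (hF : ContinuousOn F (Icc a b))
    (hg : MemLp g 2 (volume.restrict (Icc a b))) :
    ∃ f : sobolev a b E, (∀ x : Icc a b, contRep hab f x = F x) ∧
      (f : L2 a b E) =ᵐ[volume.restrict (Icc a b)] F ∧
      weakDeriv a b E f =ᵐ[volume.restrict (Icc a b)] g := by
  have hF2 : MemLp F 2 (volume.restrict (Icc a b)) := memLp_of_continuousOn hF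
  have hw : IsWeakDeriv (hF2.toLp F) (hg.toLp g) :=
    (h.congr_ae hF2.coeFn_toLp.symm hg.coeFn_toLp.symm).test
  let f : sobolev a b E := ⟨hF2.toLp F, _, hw⟩
  refine ⟨f, fun x => ?_, hF2.coeFn_toLp, ?_⟩
  · have h1 : IccExtend hab.le (contRep hab f) =ᵐ[volume.restrict (Icc a b)] F :=
      EventuallyEq.trans (EventuallyEq.symm (contRep_spec hab f)) hF2.coeFn_toLp
    have h2 := Measure.eqOn_Icc_of_ae_eq volume hab.ne h1
      ((contRep hab f).continuous.Icc_extend').continuousOn hF x.2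
    rwa [IccExtend_of_mem _ _ x.2] at h2
  · rw [(weakDeriv_spec f).unique hw]
    exact hg.coeFn_toLp

end WeakDerivative

/-! ### The energy identity -/

section Energy

variable {a b : ℝ} {E : Type} [NormedAddCommGroup E] [InnerProductSpace ℂ E] [CompleteSpace E]

/-- Energy identity: `‖f‖²` is a primitive of `2 Re ⟪f', f⟫`. -/
theorem HasWeakDeriv.integral_re_inner (hab : a < b) {f g : ℝ → E} (h : HasWeakDeriv a b f g)
    (hf : ContinuousOn f (Icc a b)) {s : ℝ} (hs : s ∈ Icc a b) :
    ∫ x in s..b, 2 * (inner ℂ (g x) (f x)).re = ‖f b‖ ^ 2 - ‖f s‖ ^ 2 := by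
  have hgi : IntervalIntegrable g volume a b :=
    (intervalIntegrable_iff_integrableOn_Icc_of_le hab.le).2 h.right
  obtain ⟨C, hC⟩ := isCompact_Icc.exists_bound_of_continuousOn hf
  let F : ℝ → E := fun x => f a + ∫ t in a..x, g t
  have hF : ∀ x ∈ Icc a b, f x = F x := fun x hx => h.eq_add_integral hab hf hx
  have acG : AbsolutelyContinuousOnInterval (fun x => ∫ t in a..x, ‖g t‖) a b :=
    hgi.norm.absolutelyContinuousOnInterval_intervalIntegral (c := a) left_mem_uIcc
  -- increments of `‖F‖²` are at most `2 C` times those of the primitive of `‖g‖`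
  have ac : AbsolutelyContinuousOnInterval (fun x => ‖F x‖ ^ 2) a b := by
    have h0 := Tendsto.const_mul (2 * C) acG
    rw [mul_zero] at h0
    refine squeeze_zero' (Eventually.of_forall fun _ => Finset.sum_nonneg fun _ _ => dist_nonneg)
      ?_ h0
    filter_upwards [mem_inf_of_right (mem_principal_self _)] with P hP
    rw [Finset.mul_sum]
    refine Finset.sum_le_sum fun i hi => ?_
    obtain ⟨h1, h2⟩ := hP.1 i hi
    rw [uIcc_of_le hab.le] at h1 h2
    have n1 : ‖F (P.2 i).1‖ ≤ C := by rw [← hF _ h1]; exact hC _ h1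
    have n2 : ‖F (P.2 i).2‖ ≤ C := by rw [← hF _ h2]; exact hC _ h2
    have n3 := abs_norm_sub_norm_le (F (P.2 i).1) (F (P.2 i).2)
    have sub : ∀ {r}, r ∈ Icc a b → uIcc a r ⊆ uIcc a b := fun {r} hr => by
      rw [uIcc_of_le hr.1, uIcc_of_le hab.le]; exact Icc_subset_Icc_right hr.2
    have n4 : ‖F (P.2 i).1 - F (P.2 i).2‖
        ≤ dist (∫ t in a..(P.2 i).1, ‖g t‖) (∫ t in a..(P.2 i).2, ‖g t‖) := by
      simp only [F, add_sub_add_left_eq_sub]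
      rw [Real.dist_eq, intervalIntegral.integral_interval_sub_left (hgi.mono_set (sub h1))
        (hgi.mono_set (sub h2)), intervalIntegral.integral_interval_sub_left
        (hgi.norm.mono_set (sub h1)) (hgi.norm.mono_set (sub h2))]
      exact intervalIntegral.norm_integral_le_abs_integral_norm
    rw [Real.dist_eq, sq_sub_sq, abs_mul, abs_of_nonneg (by positivity)]
    exact mul_le_mul (by linarith) (n3.trans n4) (abs_nonneg _)
      (by linarith [norm_nonneg (F (P.2 i).1)])
  have hsub : uIcc s b ⊆ uIcc a b := by
    rw [uIcc_of_le hs.2, uIcc_of_le hab.le]; exact Icc_subset_Icc_left hs.1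
  have h1 := (ac.mono hsub).integral_deriv_eq_sub
  rw [← hF s hs, ← hF b (right_mem_Icc.2 hab.le)] at h1
  rw [← h1]
  refine intervalIntegral.integral_congr_ae ?_
  filter_upwards [hgi.ae_hasDerivAt_integral] with x hx hxs
  have hx' : x ∈ uIcc a b := hsub (uIoc_subset_uIcc hxs)
  have hd : HasDerivAt F (g x) x := (hx hx' a left_mem_uIcc).const_add _
  have h2 := Complex.reCLM.hasFDerivAt.comp_hasDerivAt x (hd.inner ℂ hd)
  have h3 : HasDerivAt (fun r => ‖F r‖ ^ 2) (2 * (inner ℂ (g x) (F x)).re) x := by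
    refine (h2.congr_deriv ?_).congr_of_eventuallyEq (Eventually.of_forall fun r => ?_)
    · rw [map_add, Complex.reCLM_apply, Complex.reCLM_apply, ← inner_conj_symm (F x),
        Complex.conj_re]; ring
    · exact (inner_self_eq_norm_sq (𝕜 := ℂ) _).symm
  rw [uIcc_of_le hab.le] at hx'
  rw [h3.deriv, hF x hx']

end Energy

/-! ### Preliminaries on `L²` -/

section LpPreliminaries

variable {X : Type*} [MeasurableSpace X] {m : Measure X}
  {F : Type*} [NormedAddCommGroup F] [InnerProductSpace ℂ F]

theorem re_inner_eq_integral (f g : Lp F 2 m) :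
    (inner ℂ f g).re = ∫ x, (inner ℂ (f x) (g x)).re ∂m := by
  rw [L2.inner_def]
  exact (integral_re (L2.integrable_inner (𝕜 := ℂ) f g)).symm

/-- The Cauchy–Schwarz inequality against the constant function `1`. -/
theorem sq_integral_le [IsFiniteMeasure m] {h : X → ℝ} (h1 : Integrable h m)
    (h2 : Integrable (fun x => h x ^ 2) m) :
    (∫ x, h x ∂m) ^ 2 ≤ m.real univ * ∫ x, h x ^ 2 ∂m := by
  set c := m.real univ with hc
  set I := ∫ x, h x ∂m
  rcases (measureReal_nonneg (μ := m) (s := univ)).eq_or_lt with h0 | h0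
  · have : m = 0 := by
      rw [← Measure.measure_univ_eq_zero]
      exact (measureReal_eq_zero_iff (measure_ne_top _ _)).1 h0.symm
    simp [I, this]
  · have h3 : 0 ≤ ∫ x, (c * h x - I) ^ 2 ∂m := integral_nonneg fun x => sq_nonneg _
    have e : ∀ x, (c * h x - I) ^ 2 = c ^ 2 * h x ^ 2 - 2 * c * I * h x + I ^ 2 := fun x => by ring
    simp_rw [e] at h3
    have i1 : Integrable (fun x => c ^ 2 * h x ^ 2) m := h2.const_mul _
    have i2 : Integrable (fun x => 2 * c * I * h x) m := h1.const_mul _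
    have i3 : Integrable (fun x => c ^ 2 * h x ^ 2 - 2 * c * I * h x) m := i1.sub i2
    rw [integral_add i3 (integrable_const _), integral_sub i1 i2, integral_const_mul,
      integral_const_mul, integral_const, smul_eq_mul, ← hc] at h3
    have h4 : 0 ≤ c * (c * (∫ x, h x ^ 2 ∂m) - I ^ 2) := by
      refine h3.trans_eq ?_
      ring
    have := nonneg_of_mul_nonneg_right h4 h0
    linarith

theorem sq_integral_norm_le [IsFiniteMeasure m] (f : Lp F 2 m) :
    (∫ x, ‖f x‖ ∂m) ^ 2 ≤ m.real univ * ‖f‖ ^ 2 := by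
  have h : ‖f‖ ^ 2 = ∫ x, ‖f x‖ ^ 2 ∂m := by
    rw [← inner_self_eq_norm_sq (𝕜 := ℂ)]
    refine (re_inner_eq_integral f f).trans (integral_congr_ae (ae_of_all _ fun x => ?_))
    exact inner_self_eq_norm_sq (𝕜 := ℂ) _
  rw [h]
  exact sq_integral_le ((Lp.memLp f).integrable (by norm_num)).norm
    (Lp.memLp f).norm.integrable_sq

/-- Multiplication by a bounded measurable real function, as an operator on `L²`. -/
def mulL2 (F : Type*) [NormedAddCommGroup F] [InnerProductSpace ℂ F] {w : X → ℝ}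
    (hw : MemLp (fun x => (w x : ℂ)) ∞ m) : Lp F 2 m →L[ℂ] Lp F 2 m :=
  (ContinuousLinearMap.lsmul ℂ ℂ).holderL m ∞ 2 2 hw.toLp

theorem coeFn_mulL2 {w : X → ℝ} (hw : MemLp (fun x => (w x : ℂ)) ∞ m) (f : Lp F 2 m) :
    mulL2 F hw f =ᵐ[m] fun x => (w x : ℂ) • f x := by
  have := ContinuousLinearMap.coeFn_holder (r := 2) (ContinuousLinearMap.lsmul ℂ ℂ) hw.toLp f
  refine EventuallyEq.trans this ?_
  filter_upwards [hw.coeFn_toLp] with x hx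
  rw [hx]; rfl

theorem memLp_top_ofReal_of_bound {w : X → ℝ} (hw : Measurable w) {C : ℝ} (hC : ∀ x, |w x| ≤ C) :
    MemLp (fun x => (w x : ℂ)) ∞ m :=
  memLp_top_of_bound (Complex.measurable_ofReal.comp hw).aestronglyMeasurable C (ae_of_all _ fun x => by
    rw [Complex.norm_real]; exact hC x)

/-- Multiplication by a measurable function with values in `[1, C]` is an isomorphism of `L²`. -/
theorem exists_mul_equiv (F : Type*) [NormedAddCommGroup F] [InnerProductSpace ℂ F]
    {w : X → ℝ} (hw : Measurable w) {C : ℝ} (h1 : ∀ x, 1 ≤ w x)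
    (hC : ∀ x, w x ≤ C) :
    ∃ J : Lp F 2 m ≃L[ℂ] Lp F 2 m, ∀ f : Lp F 2 m, J f =ᵐ[m] fun x => (w x : ℂ) • f x := by
  have hw1 : MemLp (fun x => (w x : ℂ)) ∞ m := memLp_top_ofReal_of_bound hw fun x => by
    rw [abs_of_nonneg (by linarith [h1 x])]; exact hC x
  have hw2 : MemLp (fun x => (((w x)⁻¹ : ℝ) : ℂ)) ∞ m := memLp_top_ofReal_of_bound hw.inv (C := 1)
    fun x => by
      rw [abs_of_nonneg (inv_nonneg.2 (by linarith [h1 x]))]; exact inv_le_one_of_one_le₀ (h1 x)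
  have hne : ∀ x, (w x : ℂ) ≠ 0 := fun x => by
    exact_mod_cast (show w x ≠ 0 by linarith [h1 x])
  refine ⟨ContinuousLinearEquiv.equivOfInverse (mulL2 F hw1) (mulL2 F hw2) (fun f => ?_)
    (fun f => ?_), coeFn_mulL2 hw1⟩
  · ext
    filter_upwards [coeFn_mulL2 hw2 (mulL2 F hw1 f), coeFn_mulL2 hw1 f] with x h h'
    rw [h, h', Complex.ofReal_inv, inv_smul_smul₀ (hne x)]
  · ext
    filter_upwards [coeFn_mulL2 hw1 (mulL2 F hw2 f), coeFn_mulL2 hw2 f] with x h h'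
    rw [h, h', Complex.ofReal_inv, smul_inv_smul₀ (hne x)]

end LpPreliminaries

/-! ### The delay operator -/

section Delay

variable {n : ℕ} {μ : Icc (-1 : ℝ) 0 → (Cn n →L[ℂ] Cn n)}

theorem norm_sq_spaceIntegral_le (f : Profile n) : ‖spaceIntegral n f‖ ^ 2 ≤ ‖f‖ ^ 2 := by
  have h1 : ‖spaceIntegral n f‖ ≤ ∫ x in Icc (0 : ℝ) 1, ‖f x‖ := norm_integral_le_integral_norm _
  calc ‖spaceIntegral n f‖ ^ 2 ≤ (∫ x in Icc (0 : ℝ) 1, ‖f x‖) ^ 2 := by gcongr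
    _ ≤ _ := (sq_integral_norm_le f).trans_eq (by simp)

theorem exists_stieltjes_bound (hμ : BoundedVariationOn μ univ) :
    ∃ p : ℝ, 0 ≤ p ∧ ∀ F : C(Icc (-1 : ℝ) 0, Profile n),
      ‖stieltjes hμ F‖ ≤ p * ∫ s, ‖F s‖ ∂hμ.vectorMeasure.variation := by
  have h := fun F : C(Icc (-1 : ℝ) 0, Profile n) =>
    VectorMeasure.norm_integral_le_integral_norm (f := F) (μ := hμ.vectorMeasure) (B := pairing n)
  exact ⟨_, ContinuousLinearMap.opNorm_nonneg _, h⟩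

theorem exists_sq_stieltjes_bound (hμ : BoundedVariationOn μ univ) :
    ∃ K : ℝ, 0 ≤ K ∧ ∀ F : C(Icc (-1 : ℝ) 0, Profile n),
      ‖stieltjes hμ F‖ ^ 2 ≤ K * ∫ s, ‖F s‖ ^ 2 ∂hμ.vectorMeasure.variation := by
  obtain ⟨p, hp, hst⟩ := exists_stieltjes_bound hμ
  have := variation_lt_top hμ.vectorMeasure
  generalize hμ.vectorMeasure.variation = ν at *
  refine ⟨p ^ 2 * ν.real univ, by positivity, fun F => ?_⟩
  have hint : ∀ g : C(Icc (-1 : ℝ) 0, ℝ), Integrable g ν := fun g =>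
    g.continuous.integrable_of_hasCompactSupport (HasCompactSupport.of_compactSpace _)
  have h2 := sq_integral_le (m := ν) (h := fun s => ‖F s‖)
    (hint ⟨fun s => ‖F s‖, by fun_prop⟩) (hint ⟨fun s => ‖F s‖ ^ 2, by fun_prop⟩)
  calc ‖stieltjes hμ F‖ ^ 2 ≤ (p * ∫ s, ‖F s‖ ∂ν) ^ 2 :=
        pow_le_pow_left₀ (norm_nonneg _) (hst F) 2
    _ = p ^ 2 * (∫ s, ‖F s‖ ∂ν) ^ 2 := by ring
    _ ≤ p ^ 2 * (ν.real univ * ∫ s, ‖F s‖ ^ 2 ∂ν) := by gcongr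
    _ = _ := by ring

/-- The delay operator is controlled by the square integral of the history against the total
variation of `μ`. -/
theorem exists_delay_bound (hμ : BoundedVariationOn μ univ) :
    ∃ K : ℝ, 0 ≤ K ∧ ∀ φ : sobolev (-1) 0 (Profile n),
      ‖delayOp hμ φ‖ ^ 2 ≤
        K * ∫ s, ‖contRep neg_one_lt_zero φ s‖ ^ 2 ∂hμ.vectorMeasure.variation := by
  obtain ⟨K, hK, h⟩ := exists_sq_stieltjes_bound hμ
  refine ⟨K, hK, fun φ => ?_⟩
  exact (norm_sq_spaceIntegral_le (stieltjes hμ (contRep neg_one_lt_zero φ))).trans (h _)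

end Delay

/-! ### The weight on the history -/

section Weight

/-- The weight `θ ↦ 1 + K ν([-1, θ])` on the history interval. Its growth absorbs the delay term. -/
def weight (K : ℝ) (ν : Measure (Icc (-1 : ℝ) 0)) (θ : ℝ) : ℝ :=
  1 + K * ν.real {s | (s : ℝ) ≤ θ}

variable {K : ℝ} {ν : Measure (Icc (-1 : ℝ) 0)}

theorem one_le_weight (hK : 0 ≤ K) (θ : ℝ) : 1 ≤ weight K ν θ :=
  le_add_of_nonneg_right (mul_nonneg hK measureReal_nonneg)

variable [IsFiniteMeasure ν]

theorem weight_le (hK : 0 ≤ K) (θ : ℝ) : weight K ν θ ≤ 1 + K * ν.real univ := by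
  unfold weight
  gcongr
  · exact measure_ne_top _ _
  · exact subset_univ _

theorem measurable_weight (hK : 0 ≤ K) : Measurable (weight K ν) := by
  refine Monotone.measurable fun θ θ' h => ?_
  unfold weight
  gcongr
  exact measure_ne_top _ _

/-- Integration by parts against the weight, in the form of Fubini's theorem. -/
theorem integral_weight_mul {q : ℝ → ℝ} (hq : IntegrableOn q (Icc (-1) 0)) :
    ∫ θ in Icc (-1 : ℝ) 0, weight K ν θ * q θ =
      (∫ θ in Icc (-1 : ℝ) 0, q θ) + K * ∫ s, (∫ θ in (s : ℝ)..0, q θ) ∂ν := by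
  let S : Set (ℝ × Icc (-1 : ℝ) 0) := {p | (p.2 : ℝ) ≤ p.1}
  have hS : MeasurableSet S := measurableSet_le (by fun_prop) (by fun_prop)
  let k : ℝ → Icc (-1 : ℝ) 0 → ℝ := fun θ s => S.indicator (fun p => q p.1) (θ, s)
  have hk : Integrable (Function.uncurry k) ((volume.restrict (Icc (-1 : ℝ) 0)).prod ν) :=
    (hq.comp_fst ν).indicator hS
  have hswap := integral_integral_swap hk
  have e1 : ∀ θ, ∫ s, k θ s ∂ν = ν.real {s | (s : ℝ) ≤ θ} * q θ := by
    intro θ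
    have : ∀ s, k θ s = {s : Icc (-1 : ℝ) 0 | (s : ℝ) ≤ θ}.indicator (fun _ => q θ) s := by
      intro s
      simp only [k, S, indicator_apply, mem_ofPred_eq]
    simp_rw [this]
    rw [integral_indicator_const _ (measurableSet_le (by fun_prop) (by fun_prop)), smul_eq_mul]
  have e2 : ∀ s : Icc (-1 : ℝ) 0, ∫ θ in Icc (-1 : ℝ) 0, k θ s = ∫ θ in (s : ℝ)..0, q θ := by
    intro s
    have : ∀ θ, k θ s = (Ici (s : ℝ)).indicator q θ := by
      intro θ
      simp only [k, S, indicator_apply, mem_ofPred_eq, mem_Ici]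
    simp_rw [this]
    rw [setIntegral_indicator measurableSet_Ici, intervalIntegral.integral_of_le s.2.2,
      ← integral_Icc_eq_integral_Ioc]
    congr 2
    ext θ
    simp only [mem_inter_iff, mem_Icc, mem_Ici]
    exact ⟨fun h => ⟨h.2, h.1.2⟩, fun h => ⟨⟨s.2.1.trans h.1, h.2⟩, h.1⟩⟩
  simp_rw [e1, e2] at hswap
  have e3 : ∀ θ, weight K ν θ * q θ = q θ + K * (ν.real {s | (s : ℝ) ≤ θ} * q θ) := fun θ => by
    unfold weight; ring
  simp_rw [e3]
  have hi : IntegrableOn (fun θ => ν.real {s | (s : ℝ) ≤ θ} * q θ) (Icc (-1) 0) := by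
    have := hk.integral_prod_left
    simp only [Function.uncurry, e1] at this
    exact this
  rw [integral_add hq (hi.const_mul K), integral_const_mul, hswap]

end Weight

/-! ### Diagonal matrices -/

section Velocity

variable {n : ℕ}

theorem velocity_apply (d : Fin n → ℝ) (u : Cn n) (i : Fin n) :
    velocity d u i = (d i : ℂ) * u i := by
  simp [velocity, Matrix.mulVec_diagonal]

theorem inner_velocity (d : Fin n → ℝ) (u v : Cn n) :
    inner ℂ (velocity d u) v = inner ℂ u (velocity d v) := by
  simp only [PiLp.inner_apply, velocity_apply]
  refine Finset.sum_congr rfl fun i _ => ?_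
  simp only [RCLike.inner_apply, map_mul, Complex.conj_ofReal]
  ring

theorem velocity_velocity (d e : Fin n → ℝ) (u : Cn n) :
    velocity d (velocity e u) = velocity (fun i => d i * e i) u := by
  ext i
  simp only [velocity_apply]; push_cast; ring

theorem velocity_one (u : Cn n) : velocity (fun _ => 1) u = u := by
  ext i
  simp [velocity_apply]

/-- Acting by the diagonal matrix `D^{-1/2}`, as an isomorphism of the space of profiles. -/
theorem exists_velocity_equiv {d : Fin n → ℝ} (hd : ∀ i, 0 < d i) :
    ∃ J : Profile n ≃L[ℂ] Profile n, ∀ f : Profile n,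
      J f =ᵐ[volume.restrict (Icc (0 : ℝ) 1)] fun x => velocity (fun i => (√(d i))⁻¹) (f x) := by
  let P : Cn n →L[ℂ] Cn n := velocity (fun i => (√(d i))⁻¹)
  let Q : Cn n →L[ℂ] Cn n := velocity (fun i => √(d i))
  have hs : ∀ i, √(d i) ≠ 0 := fun i => (Real.sqrt_pos.2 (hd i)).ne'
  have hPQ : ∀ u, P (Q u) = u := fun u => by
    simp only [P, Q, velocity_velocity, inv_mul_cancel₀ (hs _), velocity_one]
  have hQP : ∀ u, Q (P u) = u := fun u => by
    simp only [P, Q, velocity_velocity, mul_inv_cancel₀ (hs _), velocity_one]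
  refine ⟨ContinuousLinearEquiv.equivOfInverse (P.compLpL 2 _) (Q.compLpL 2 _) (fun f => ?_)
    (fun f => ?_), fun f => P.coeFn_compLpL f⟩
  · ext1
    filter_upwards [Q.coeFn_compLpL (P.compLpL 2 (volume.restrict (Icc (0 : ℝ) 1)) f),
      P.coeFn_compLpL f] with x h h'
    rw [h, h', hQP]
  · ext1
    filter_upwards [P.coeFn_compLpL (Q.compLpL 2 (volume.restrict (Icc (0 : ℝ) 1)) f),
      Q.coeFn_compLpL f] with x h h'
    rw [h, h', hPQ]

end Velocity

/-! ### Quasi-dissipativity of the closed-loop operator -/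

section Dissipative

variable {n : ℕ} {μ : Icc (-1 : ℝ) 0 → (Cn n →L[ℂ] Cn n)}

theorem integral_re_inner_weakDeriv {a b : ℝ} {E : Type} [NormedAddCommGroup E]
    [InnerProductSpace ℂ E] [CompleteSpace E] (hab : a < b) (f : sobolev a b E) :
    ∫ x in Icc a b, (inner ℂ (weakDeriv a b E f x) ((f : L2 a b E) x)).re =
      (‖contRep hab f ⟨b, right_mem_Icc.2 hab.le⟩‖ ^ 2
        - ‖contRep hab f ⟨a, left_mem_Icc.2 hab.le⟩‖ ^ 2) / 2 := by
  have h := (contRep_hasWeakDeriv hab f).integral_re_inner hab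
    ((contRep hab f).continuous.Icc_extend').continuousOn (left_mem_Icc.2 hab.le)
  rw [IccExtend_of_mem _ _ (left_mem_Icc.2 hab.le), IccExtend_of_mem _ _ (right_mem_Icc.2 hab.le),
    intervalIntegral.integral_of_le hab.le, ← integral_Icc_eq_integral_Ioc,
    integral_const_mul] at h
  rw [← h, mul_div_cancel_left₀ _ (two_ne_zero)]
  refine integral_congr_ae ?_
  filter_upwards [contRep_spec hab f] with x hx
  rw [hx]

/-- In the Hilbert norm `∫ |D^{-1/2} f|² + ∫ (1 + K ν([-1,θ])) |φ(θ)|² dθ`, where `ν` is the total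
variation of `μ`, the closed-loop operator is quasi-dissipative: the boundary term `|f(0)|²/2`
is at most `K/2 ∫ |φ|² dν`, which the weight on the history compensates. -/
theorem exists_dissipative_equiv {d : Fin n → ℝ} (hd : ∀ i, 0 < d i)
    (hμ : BoundedVariationOn μ univ) :
    ∃ (J : State n ≃L[ℂ] WithLp 2 (State n)) (κ : ℝ), ∀ z : maxDomain n,
      traceOp n z = feedbackOp hμ z →
        (inner ℂ (J (maxOp d z)) (J (z : State n))).re ≤ κ * ‖J (z : State n)‖ ^ 2 := by
  have := variation_lt_top hμ.vectorMeasure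
  obtain ⟨K, hK, hdelay⟩ := exists_delay_bound hμ
  set ν := hμ.vectorMeasure.variation
  let M : ℝ := 1 + K * ν.real univ
  have hM : 0 ≤ M := by positivity
  obtain ⟨J₁, hJ₁⟩ := exists_velocity_equiv hd
  obtain ⟨J₂, hJ₂⟩ := exists_mul_equiv (m := volume.restrict (Icc (-1 : ℝ) 0)) (Profile n)
    (w := fun θ => √(weight K ν θ)) ((measurable_weight hK).sqrt) (C := √M)
    (fun θ => Real.one_le_sqrt.2 (one_le_weight hK θ))
    (fun θ => Real.sqrt_le_sqrt (weight_le hK θ))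
  let J : State n ≃L[ℂ] WithLp 2 (State n) :=
    (J₁.prodCongr J₂).trans (WithLp.prodContinuousLinearEquiv 2 ℂ (Profile n) (History n)).symm
  refine ⟨J, M / 2 * ‖(J₁.symm : Profile n →L[ℂ] Profile n)‖ ^ 2, fun z hz => ?_⟩
  set f := profilePart n z
  set φ := historyPart n z
  have hz1 : contRep zero_lt_one f ⟨0, left_mem_Icc.2 zero_le_one⟩ = delayOp hμ φ :=
    congrArg Prod.fst hz
  have hz2 : contRep neg_one_lt_zero φ ⟨0, right_mem_Icc.2 neg_one_lt_zero.le⟩ = (f : Profile n) :=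
    congrArg Prod.snd hz
  have hinner : inner ℂ (J (maxOp d z)) (J (z : State n))
      = inner ℂ (J₁ (transportOp d f)) (J₁ f) +
        inner ℂ (J₂ (weakDeriv (-1) 0 (Profile n) φ)) (J₂ φ) := rfl
  have hnorm : ‖J (z : State n)‖ ^ 2 = ‖J₁ f‖ ^ 2 + ‖J₂ φ‖ ^ 2 :=
    WithLp.prod_norm_sq_eq_of_L2 _
  -- the profile part
  have h1 : (inner ℂ (J₁ (transportOp d f)) (J₁ f)).re ≤ ‖delayOp hμ φ‖ ^ 2 / 2 := by
    have e : (inner ℂ (J₁ (transportOp d f)) (J₁ f)).re =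
        -∫ x in Icc (0 : ℝ) 1, (inner ℂ (weakDeriv 0 1 (Cn n) f x) ((f : Profile n) x)).re := by
      rw [re_inner_eq_integral, ← integral_neg]
      refine integral_congr_ae ?_
      have hT : transportOp d f = -((velocity d).compLpL 2 (volume.restrict (Icc (0 : ℝ) 1))
        (weakDeriv 0 1 (Cn n) f)) := rfl
      filter_upwards [hJ₁ (transportOp d f), hJ₁ f, Lp.coeFn_neg ((velocity d).compLpL 2
        (volume.restrict (Icc (0 : ℝ) 1)) (weakDeriv 0 1 (Cn n) f)),
        (velocity d).coeFn_compLpL (weakDeriv 0 1 (Cn n) f)] with x h h' h'' h'''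
      rw [h, h', hT, h'', Pi.neg_apply, h''', map_neg, inner_neg_left, ← inner_velocity,
        velocity_velocity, velocity_velocity]
      have : (fun i => (√(d i))⁻¹ * (√(d i))⁻¹ * d i) = fun _ => 1 := by
        funext i
        have hs := (Real.sqrt_pos.2 (hd i)).ne'
        nth_rewrite 3 [← Real.mul_self_sqrt (hd i).le]
        field_simp
      rw [this, velocity_one]; rfl
    rw [e, integral_re_inner_weakDeriv zero_lt_one, hz1]
    have := sq_nonneg ‖contRep zero_lt_one f ⟨1, right_mem_Icc.2 zero_le_one⟩‖
    linarith
  -- the history part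
  have h2 : (inner ℂ (J₂ (weakDeriv (-1) 0 (Profile n) φ)) (J₂ φ)).re ≤
      M / 2 * ‖(f : Profile n)‖ ^ 2
        - K / 2 * ∫ s, ‖contRep neg_one_lt_zero φ s‖ ^ 2 ∂ν := by
    set q : ℝ → ℝ := fun θ => (inner ℂ (weakDeriv (-1) 0 (Profile n) φ θ) ((φ : History n) θ)).re
    have hq : IntegrableOn q (Icc (-1) 0) :=
      (L2.integrable_inner (𝕜 := ℂ) (weakDeriv (-1) 0 (Profile n) φ) (φ : History n)).re
    have e : (inner ℂ (J₂ (weakDeriv (-1) 0 (Profile n) φ)) (J₂ φ)).re =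
        ∫ θ in Icc (-1 : ℝ) 0, weight K ν θ * q θ := by
      rw [re_inner_eq_integral]
      refine integral_congr_ae ?_
      filter_upwards [hJ₂ (weakDeriv (-1) 0 (Profile n) φ), hJ₂ φ] with θ h h'
      rw [h, h', inner_smul_left, inner_smul_right, Complex.conj_ofReal, Complex.re_ofReal_mul,
        Complex.re_ofReal_mul, ← mul_assoc,
        Real.mul_self_sqrt (by linarith [one_le_weight (ν := ν) hK θ])]
    have hs : ∀ s : Icc (-1 : ℝ) 0, ∫ θ in (s : ℝ)..0, q θ =
        (‖(f : Profile n)‖ ^ 2 - ‖contRep neg_one_lt_zero φ s‖ ^ 2) / 2 := by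
      intro s
      have h := (contRep_hasWeakDeriv neg_one_lt_zero φ).integral_re_inner neg_one_lt_zero
        ((contRep neg_one_lt_zero φ).continuous.Icc_extend').continuousOn s.2
      rw [IccExtend_of_mem _ _ s.2, IccExtend_of_mem _ _ (right_mem_Icc.2 neg_one_lt_zero.le), hz2,
        intervalIntegral.integral_const_mul] at h
      rw [← h, mul_div_cancel_left₀ _ (two_ne_zero)]
      refine intervalIntegral.integral_congr_ae ?_
      have h3 := (ae_restrict_iff' measurableSet_Icc).1 (contRep_spec neg_one_lt_zero φ)
      filter_upwards [h3] with θ hθ hθs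
      rw [uIoc_of_le s.2.2] at hθs
      simp only [q]
      rw [hθ ⟨s.2.1.trans hθs.1.le, hθs.2⟩]
    have hs1 : ∫ θ in Icc (-1 : ℝ) 0, q θ ≤ ‖(f : Profile n)‖ ^ 2 / 2 := by
      rw [integral_re_inner_weakDeriv neg_one_lt_zero, hz2]
      have := sq_nonneg ‖contRep neg_one_lt_zero φ ⟨-1, left_mem_Icc.2 neg_one_lt_zero.le⟩‖
      linarith
    have hint : Integrable (fun s => ‖contRep neg_one_lt_zero φ s‖ ^ 2) ν :=
      Continuous.integrable_of_hasCompactSupport (by fun_prop)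
        (HasCompactSupport.of_compactSpace _)
    rw [e, integral_weight_mul hq]
    simp_rw [hs]
    rw [integral_div, integral_sub (integrable_const _) hint, integral_const, smul_eq_mul]
    simp only [M]
    nlinarith
  have h3 : ‖(f : Profile n)‖ ^ 2 ≤
      ‖(J₁.symm : Profile n →L[ℂ] Profile n)‖ ^ 2 * ‖J (z : State n)‖ ^ 2 := by
    have h4 : ‖(f : Profile n)‖ ≤ ‖(J₁.symm : Profile n →L[ℂ] Profile n)‖ * ‖J₁ f‖ := by
      have := (J₁.symm : Profile n →L[ℂ] Profile n).le_opNorm (J₁ f)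
      simpa using this
    calc ‖(f : Profile n)‖ ^ 2 ≤ (‖(J₁.symm : Profile n →L[ℂ] Profile n)‖ * ‖J₁ f‖) ^ 2 := by gcongr
      _ = ‖(J₁.symm : Profile n →L[ℂ] Profile n)‖ ^ 2 * ‖J₁ f‖ ^ 2 := by ring
      _ ≤ _ := by
        rw [hnorm]
        exact mul_le_mul_of_nonneg_left (le_add_of_nonneg_right (sq_nonneg _)) (sq_nonneg _)
  rw [hinner, Complex.add_re]
  have h5 := hdelay φ
  have h6 := mul_le_mul_of_nonneg_left h3 (div_nonneg hM zero_le_two)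
  linarith

end Dissipative

/-! ### A linear differential equation -/

section LinearODE

variable {a b : ℝ} {E : Type} [NormedAddCommGroup E] [NormedSpace ℂ E]

/-- The solution `x ↦ e^{κ x} (w - ∫_a^x e^{-κ t} p(t) dt)` of `f' = κ f - p`. -/
def odeSol (a : ℝ) (κ : ℝ) (p : ℝ → E) (w : E) (x : ℝ) : E :=
  Real.exp (κ * x) • (w + ∫ t in a..x, -(Real.exp (-(κ * t)) • p t))

theorem odeSol_integrand_integrable {p : ℝ → E} (hp : IntegrableOn p (Icc a b)) (κ : ℝ) :
    IntegrableOn (fun t => -(Real.exp (-(κ * t)) • p t)) (Icc a b) :=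
  (hp.continuousOn_smul (by fun_prop) isCompact_Icc).neg

theorem continuousOn_odeSol (hab : a < b) {p : ℝ → E} (hp : IntegrableOn p (Icc a b)) (κ : ℝ)
    (w : E) : ContinuousOn (odeSol a κ p w) (Icc a b) := by
  have hi := (intervalIntegrable_iff_integrableOn_Icc_of_le hab.le).2
    (odeSol_integrand_integrable hp κ)
  have h := intervalIntegral.continuousOn_primitive_interval' hi left_mem_uIcc
  rw [uIcc_of_le hab.le] at h
  unfold odeSol
  have he : Continuous fun x : ℝ => Real.exp (κ * x) := by fun_prop
  exact he.continuousOn.smul (continuousOn_const.add h)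

theorem hasWeakDeriv_odeSol [CompleteSpace E] (hab : a < b) {p : ℝ → E}
    (hp : IntegrableOn p (Icc a b)) (κ : ℝ) (w : E) :
    HasWeakDeriv a b (odeSol a κ p w) (fun x => κ • odeSol a κ p w x - p x) := by
  have hs : ContDiff ℝ ∞ (fun x : ℝ => Real.exp (κ * x)) := by fun_prop
  have hd : ∀ x, deriv (fun x : ℝ => Real.exp (κ * x)) x = κ * Real.exp (κ * x) := fun x => by
    have : HasDerivAt (fun x : ℝ => Real.exp (κ * x)) (Real.exp (κ * x) * κ) x := by
      simpa using ((hasDerivAt_id x).const_mul κ).exp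
    rw [this.deriv, mul_comm]
  refine ((HasWeakDeriv.primitive hab (odeSol_integrand_integrable hp κ) w).smul hs).congr_ae
    (ae_eq_refl _) (ae_of_all _ fun x => ?_)
  simp only
  rw [hd, smul_neg, smul_smul, ← Real.exp_add, add_neg_cancel, Real.exp_zero, one_smul, mul_smul,
    ← sub_eq_add_neg]
  rfl

theorem odeSol_left (κ : ℝ) (p : ℝ → E) (w : E) :
    odeSol a κ p w a = Real.exp (κ * a) • w := by
  simp [odeSol]

end LinearODE

/-! ### The resolvent equation -/

section ResolventEquation

variable {n : ℕ}

/-- The projection onto a coordinate. -/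
def coordProj (i : Fin n) : Cn n →L[ℂ] Cn n := velocity (Pi.single i 1)

theorem sum_coordProj (u : Cn n) : ∑ i, coordProj i u = u := by
  ext j
  rw [WithLp.ofLp_sum, Finset.sum_apply, Finset.sum_eq_single j]
  · simp [coordProj, velocity_apply]
  · intro i _ hi
    simp [coordProj, velocity_apply, hi.symm]
  · simp

theorem velocity_coordProj (d : Fin n → ℝ) (i : Fin n) (u : Cn n) :
    velocity d (coordProj i u) = d i • coordProj i u := by
  ext j
  rw [coordProj, velocity_apply, velocity_apply, PiLp.smul_apply, velocity_apply]
  by_cases h : j = i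
  · subst h; simp
  · simp [h]

/-- The equation `c f + D f' = h` with `f(0) = w` is solvable. It decouples into the scalar
equations `f_i' = - (c / d_i) f_i + h_i / d_i`. -/
theorem exists_transport_resolvent {d : Fin n → ℝ} (hd : ∀ i, 0 < d i) (c : ℝ) (h : Profile n)
    (w : Cn n) : ∃ f : sobolev 0 1 (Cn n), (c : ℂ) • (f : Profile n) - transportOp d f = h ∧
      evalAt zero_lt_one ⟨0, left_mem_Icc.2 zero_le_one⟩ f = w := by
  have hp : ∀ i, IntegrableOn (fun x => -((d i)⁻¹ • h x)) (Icc 0 1) := fun i =>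
    (h.integrable.smul (d i)⁻¹).neg
  let F : ℝ → Cn n := fun x =>
    ∑ i, coordProj i (odeSol 0 (-(c / d i)) (fun x => -((d i)⁻¹ • h x)) w x)
  let G : ℝ → Cn n := fun x => velocity (fun i => (d i)⁻¹) (h x - c • F x)
  have hFc : ContinuousOn F (Icc 0 1) :=
    continuousOn_finsetSum _ fun i _ => (coordProj i).continuous.comp_continuousOn
      (continuousOn_odeSol zero_lt_one (hp i) _ _)
  have hFG : HasWeakDeriv 0 1 F G := by
    refine (HasWeakDeriv.sum (s := Finset.univ) fun i _ =>
      (hasWeakDeriv_odeSol zero_lt_one (hp i) (-(c / d i)) w).clm (coordProj i)).congr_ae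
      (ae_eq_refl _) (ae_of_all _ fun x => ?_)
    simp only [G, F]
    nth_rewrite 2 [← sum_coordProj (h x)]
    rw [Finset.smul_sum, ← Finset.sum_sub_distrib, map_sum]
    refine Finset.sum_congr rfl fun i _ => ?_
    rw [map_sub, map_sub, map_neg, ← Complex.coe_smul, ← Complex.coe_smul, ← Complex.coe_smul,
      map_smul, map_smul, map_smul, velocity_coordProj, velocity_coordProj, ← Complex.coe_smul,
      ← Complex.coe_smul, smul_smul, div_eq_mul_inv]
    push_cast
    module
  have hG : MemLp G 2 (volume.restrict (Icc (0 : ℝ) 1)) :=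
    (velocity (fun i => (d i)⁻¹)).comp_memLp'
      ((Lp.memLp h).sub ((memLp_of_continuousOn hFc).const_smul c))
  obtain ⟨f, hf, hfF, hf'⟩ := hFG.exists_sobolev zero_lt_one hFc hG
  refine ⟨f, ?_, ?_⟩
  · have hT : transportOp d f = -((velocity d).compLpL 2 (volume.restrict (Icc (0 : ℝ) 1))
        (weakDeriv 0 1 (Cn n) f)) := rfl
    rw [hT, sub_neg_eq_add]
    ext1
    filter_upwards [Lp.coeFn_add ((c : ℂ) • (f : Profile n)) ((velocity d).compLpL 2
      (volume.restrict (Icc (0 : ℝ) 1)) (weakDeriv 0 1 (Cn n) f)),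
      Lp.coeFn_smul (c : ℂ) (f : Profile n), (velocity d).coeFn_compLpL (weakDeriv 0 1 (Cn n) f),
      hfF, hf'] with x h1 h2 h3 h4 h5
    have hdd : (fun i => d i * (d i)⁻¹) = fun _ => 1 := funext fun i => mul_inv_cancel₀ (hd i).ne'
    rw [h1, Pi.add_apply, h2, Pi.smul_apply, h3, h4, h5]
    simp only [G]
    rw [velocity_velocity, hdd, velocity_one, Complex.coe_smul]
    abel
  · refine (hf _).trans ?_
    simp only [F, odeSol_left, mul_zero, Real.exp_zero, one_smul, sum_coordProj]

/-- The equation `c φ - φ' = ψ` with prescribed right end value `φ(b) = w` is solvable. -/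
theorem exists_shift_resolvent {a b : ℝ} (hab : a < b) {E : Type} [NormedAddCommGroup E]
    [NormedSpace ℂ E] [CompleteSpace E] (c : ℝ) (ψ : L2 a b E) (w : E) :
    ∃ φ : sobolev a b E, (c : ℂ) • (φ : L2 a b E) - weakDeriv a b E φ = ψ ∧
      evalAt hab ⟨b, right_mem_Icc.2 hab.le⟩ φ = w := by
  let u : E := Real.exp (-(c * b)) • w - ∫ t in a..b, -(Real.exp (-(c * t)) • ψ t)
  let F : ℝ → E := odeSol a c ψ u
  have hFc : ContinuousOn F (Icc a b) := continuousOn_odeSol hab ψ.integrable c u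
  obtain ⟨φ, hφ, hφF, hφ'⟩ := (hasWeakDeriv_odeSol hab ψ.integrable c u).exists_sobolev hab hFc
    (((memLp_of_continuousOn hFc).const_smul c).sub (Lp.memLp ψ))
  refine ⟨φ, ?_, ?_⟩
  · ext1
    filter_upwards [Lp.coeFn_sub ((c : ℂ) • (φ : L2 a b E)) (weakDeriv a b E φ),
      Lp.coeFn_smul (c : ℂ) (φ : L2 a b E), hφF, hφ'] with x h1 h2 h3 h4
    rw [h1, Pi.sub_apply, h2, Pi.smul_apply, h3, h4, Complex.coe_smul]
    exact sub_sub_cancel _ _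
  · refine (hφ _).trans ?_
    simp only [odeSol, u, sub_add_cancel, smul_smul]
    rw [← Real.exp_add, add_neg_cancel, Real.exp_zero, one_smul]

/-- The resolvent equation with prescribed inflow `f(0) = w` and the compatibility condition
`φ(0) = f` is solvable. -/
theorem exists_maxOp_resolvent {d : Fin n → ℝ} (hd : ∀ i, 0 < d i) (c : ℝ) (y : State n)
    (w : Cn n) : ∃ z : maxDomain n, (c : ℂ) • (z : State n) - maxOp d z = y ∧
      traceOp n z = (w, (profilePart n z : Profile n)) := by
  obtain ⟨f, hf, hf0⟩ := exists_transport_resolvent hd c y.1 w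
  obtain ⟨φ, hφ, hφ0⟩ := exists_shift_resolvent neg_one_lt_zero c y.2 (f : Profile n)
  exact ⟨⟨(f, φ), f.2, φ.2⟩, Prod.ext hf hφ, Prod.ext hf0 hφ0⟩

variable {μ : Icc (-1 : ℝ) 0 → (Cn n →L[ℂ] Cn n)}

/-- If `c` is not an eigenvalue of the closed-loop operator, then `c` minus this operator is onto:
the only obstruction is the solvability of the boundary equation for the inflow `f(0)`, which is
a linear system in `ℂⁿ`. -/
theorem exists_closedLoop_resolvent {d : Fin n → ℝ} (hd : ∀ i, 0 < d i)
    (hμ : BoundedVariationOn μ univ) (c : ℝ)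
    (hinj : ∀ z : maxDomain n, traceOp n z = feedbackOp hμ z →
      (c : ℂ) • (z : State n) - maxOp d z = 0 → z = 0) (y : State n) :
    ∃ z : maxDomain n, traceOp n z = feedbackOp hμ z ∧
      (c : ℂ) • (z : State n) - maxOp d z = y := by
  let B := (EuclideanSpace.basisFun (Fin n) ℂ).toBasis
  choose ζ hζ hζ0 using fun i => exists_maxOp_resolvent hd c 0 (B i)
  let Z : Cn n →ₗ[ℂ] maxDomain n := B.constr ℂ ζ
  have hZB : ∀ i, Z (B i) = ζ i := fun i => B.constr_basis ℂ ζ i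
  let R : maxDomain n →ₗ[ℂ] State n := (c : ℂ) • (maxDomain n).subtype - maxOp d
  let S : maxDomain n →ₗ[ℂ] Profile n := (sobolev 0 1 (Cn n)).subtype ∘ₗ profilePart n
  have hR : ∀ w, R (Z w) = 0 := fun w => by
    have : R ∘ₗ Z = 0 := B.ext fun i => by
      rw [LinearMap.comp_apply, hZB]; exact hζ i
    exact LinearMap.congr_fun this w
  have hZ0 : ∀ w, traceOp n (Z w) = (w, S (Z w)) := fun w => by
    have : traceOp n ∘ₗ Z = LinearMap.id.prod (S ∘ₗ Z) := B.ext fun i => by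
      rw [LinearMap.comp_apply, hZB, hζ0]
      refine Prod.ext rfl ?_
      exact congrArg S (hZB i).symm
    exact LinearMap.congr_fun this w
  let Φ : maxDomain n →ₗ[ℂ] Cn n := delayOp hμ ∘ₗ historyPart n
  have hfb : ∀ z, feedbackOp hμ z = (Φ z, S z) := fun z => rfl
  -- a solution with inflow `w` of the homogeneous equation meets the boundary condition iff `L w = 0`
  let L : Cn n →ₗ[ℂ] Cn n := LinearMap.id - Φ ∘ₗ Z
  have hL : ∀ w, L w = w - Φ (Z w) := fun w => rfl
  have hLinj : Function.Injective L := by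
    rw [injective_iff_map_eq_zero]
    intro w hw
    rw [hL, sub_eq_zero] at hw
    have h0 : Z w = 0 := hinj _ (by rw [hZ0, hfb, ← hw]) (hR w)
    have h1 := congrArg Prod.fst (hZ0 w)
    rw [h0, map_zero] at h1
    exact h1.symm
  obtain ⟨z₀, hz₀, hz₀'⟩ := exists_maxOp_resolvent hd c y 0
  obtain ⟨w, hw⟩ := (LinearMap.injective_iff_surjective.1 hLinj) (Φ z₀)
  rw [hL, sub_eq_iff_eq_add] at hw
  refine ⟨z₀ + Z w, ?_, ?_⟩
  · rw [map_add, hz₀', hZ0, hfb, map_add, map_add, Prod.mk_add_mk, zero_add, ← hw]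
    rfl
  · have h1 : R (z₀ + Z w) = R z₀ + R (Z w) := map_add _ _ _
    rw [hR, add_zero] at h1
    exact h1.trans hz₀

end ResolventEquation

/-! ### Translation of test functions -/

section Translation

variable {a b : ℝ}

/-- A test function as a bounded continuous function, translated by `s`. -/
def IsTest.translate {η : ℝ → ℝ} (hη : IsTest a b η) (s : ℝ) : ℝ →ᵇ ℝ :=
  BoundedContinuousFunction.ofNormedAddCommGroup (fun x => η (x + s))
    (hη.smooth.continuous.comp (by fun_prop)) hη.bound.choose fun x => hη.bound.choose_spec _

theorem IsTest.translate_apply {η : ℝ → ℝ} (hη : IsTest a b η) (s x : ℝ) :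
    hη.translate s x = η (x + s) := rfl

/-- Translation of test functions is differentiable in the supremum norm, since the second derivative
is bounded. -/
theorem IsTest.hasDerivAt_translate {η : ℝ → ℝ} (hη : IsTest a b η) (s : ℝ) :
    HasDerivAt (fun r => hη.translate r) (hη.deriv.translate s) s := by
  obtain ⟨C, hC⟩ := hη.deriv.deriv.bound
  have hC0 : 0 ≤ C := (norm_nonneg _).trans (hC 0)
  have hd : ∀ x, HasDerivAt η (_root_.deriv η x) x := fun x =>
    (hη.smooth.differentiable (by simp) x).hasDerivAt
  have hlip : ∀ x h : ℝ, ‖_root_.deriv η (x + h) - _root_.deriv η x‖ ≤ C * ‖h‖ := fun x h => by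
    have := convex_univ.norm_image_sub_le_of_norm_deriv_le (f := _root_.deriv η) (C := C)
      (fun y _ => hη.deriv.smooth.differentiable (by simp) y) (fun y _ => hC y)
      (mem_univ x) (mem_univ (x + h))
    simpa using this
  have hT : ∀ x h : ℝ, ‖η (x + h) - η x - h * _root_.deriv η x‖ ≤ C * ‖h‖ ^ 2 := by
    intro x h
    have h1 : ∀ r, HasDerivAt (fun r => η (x + r) - r * _root_.deriv η x)
        (_root_.deriv η (x + r) - _root_.deriv η x) r := fun r => by
      have h2 : HasDerivAt (fun r => η (x + r)) (_root_.deriv η (x + r)) r := by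
        simpa using (hd (x + r)).comp_const_add x r
      exact (h2.sub ((hasDerivAt_id r).mul_const (_root_.deriv η x))).congr_deriv (by simp)
    have h3 := (convex_uIcc (0 : ℝ) h).norm_image_sub_le_of_norm_hasDerivWithin_le (C := C * ‖h‖)
      (fun r _ => (h1 r).hasDerivWithinAt) (fun r hr => (hlip x r).trans (by
        gcongr
        have := abs_sub_left_of_mem_uIcc hr
        simpa using this)) left_mem_uIcc right_mem_uIcc
    have e : η (x + h) - h * _root_.deriv η x - (η (x + 0) - 0 * _root_.deriv η x)
        = η (x + h) - η x - h * _root_.deriv η x := by rw [add_zero]; ring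
    rw [e, sub_zero] at h3
    exact h3.trans_eq (by ring)
  rw [hasDerivAt_iff_isLittleO_nhds_zero]
  have hO : (fun h : ℝ => hη.translate (s + h) - hη.translate s - h • hη.deriv.translate s)
      =O[𝓝 0] fun h : ℝ => h ^ 2 := by
    refine Asymptotics.IsBigO.of_bound C (Eventually.of_forall fun h => ?_)
    rw [norm_pow]
    refine (BoundedContinuousFunction.norm_le (by positivity)).2 fun x => ?_
    have := hT (x + s) h
    simpa [IsTest.translate_apply, add_assoc] using this
  exact hO.trans_isLittleO (Asymptotics.isLittleO_pow_id one_lt_two)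

variable {E : Type} [NormedAddCommGroup E] [InnerProductSpace ℂ E]

/-- The pairing `(k, φ) ↦ ∫_{-1}^0 k(θ) φ(θ) dθ`. -/
def testPairing (E : Type) [NormedAddCommGroup E] [InnerProductSpace ℂ E] :
    (ℝ →ᵇ ℝ) →L[ℝ] L2 (-1) 0 E →L[ℝ] E :=
  have hint : ∀ (k : ℝ →ᵇ ℝ) (φ : L2 (-1) 0 E),
      IntegrableOn (fun θ => k θ • φ θ) (Icc (-1) 0) := fun k φ =>
    φ.integrable.continuousOn_smul k.continuous.continuousOn isCompact_Icc
  LinearMap.mkContinuous₂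
    (LinearMap.mk₂ ℝ (fun k φ => ∫ θ in Icc (-1 : ℝ) 0, k θ • φ θ)
      (fun k k' φ => by
        rw [← integral_add (hint k φ) (hint k' φ)]
        simp [add_smul])
      (fun c k φ => by
        rw [← integral_smul]
        simp [mul_smul])
      (fun k φ φ' => by
        rw [← integral_add (hint k φ) (hint k φ')]
        refine integral_congr_ae ?_
        filter_upwards [Lp.coeFn_add φ φ'] with θ h
        rw [h, Pi.add_apply, smul_add])
      (fun c k φ => by
        rw [← integral_smul]
        refine integral_congr_ae ?_
        filter_upwards [Lp.coeFn_smul c φ] with θ h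
        rw [h, Pi.smul_apply, smul_comm])) 1
    (fun k φ => by
      rw [LinearMap.mk₂_apply, one_mul]
      have h1 : ∫ θ in Icc (-1 : ℝ) 0, ‖φ θ‖ ≤ ‖φ‖ := by
        refine abs_le_of_sq_le_sq' ?_ (norm_nonneg _) |>.2
        simpa using sq_integral_norm_le φ
      calc ‖∫ θ in Icc (-1 : ℝ) 0, k θ • φ θ‖ ≤ ∫ θ in Icc (-1 : ℝ) 0, ‖k‖ * ‖φ θ‖ := by
            refine norm_integral_le_of_norm_le (φ.integrable.norm.const_mul _)
              (ae_of_all _ fun θ => ?_)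
            rw [norm_smul]
            gcongr
            exact k.norm_coe_le_norm θ
        _ ≤ ‖k‖ * ‖φ‖ := by
            rw [integral_const_mul]; gcongr)

theorem testPairing_apply (k : ℝ →ᵇ ℝ) (φ : L2 (-1) 0 E) :
    testPairing E k φ = ∫ θ in Icc (-1 : ℝ) 0, k θ • φ θ := rfl

end Translation

/-! ### The shift equation -/

section Shift

variable {E : Type} [NormedAddCommGroup E] [InnerProductSpace ℂ E] [CompleteSpace E]

theorem testPairing_weakDeriv {η : ℝ → ℝ} (hη : IsTest (-1) 0 η) (φ : sobolev (-1) 0 E) {s : ℝ}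
    (hs : s ≤ 0) :
    testPairing E (hη.translate s) (weakDeriv (-1) 0 E φ)
        + testPairing E (hη.deriv.translate s) (φ : L2 (-1) 0 E)
      = η s • contRep neg_one_lt_zero φ ⟨0, right_mem_Icc.2 neg_one_lt_zero.le⟩ := by
  have he : ContDiff ℝ ∞ fun θ => η (θ + s) := hη.smooth.comp (by fun_prop)
  have hd : ∀ θ, deriv (fun θ => η (θ + s)) θ = deriv η (θ + s) := fun θ =>
    deriv_comp_add_const _ _ _
  have hw := (contRep_hasWeakDeriv neg_one_lt_zero φ).smul he
  have hc := (contRep neg_one_lt_zero φ).continuous.Icc_extend' (h := neg_one_lt_zero.le)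
  have h3 := hw.integral_eq_sub neg_one_lt_zero (he.continuous.smul hc).continuousOn
  rw [IccExtend_of_mem _ _ (left_mem_Icc.2 neg_one_lt_zero.le),
    IccExtend_of_mem _ _ (right_mem_Icc.2 neg_one_lt_zero.le)] at h3
  -- the outflow at `θ = -1` is not seen by the test function
  have hη1 : η (-1 + s) = 0 :=
    image_eq_zero_of_notMem_tsupport fun h => by linarith [(hη.supp h).1]
  rw [hη1, zero_smul, sub_zero, zero_add] at h3
  have i1 : IntegrableOn (fun θ => hη.deriv.translate s θ • (φ : L2 (-1) 0 E) θ) (Icc (-1) 0) :=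
    (φ : L2 (-1) 0 E).integrable.continuousOn_smul
      (BoundedContinuousFunction.continuous _).continuousOn isCompact_Icc
  have i2 : IntegrableOn (fun θ => hη.translate s θ • weakDeriv (-1) 0 E φ θ) (Icc (-1) 0) :=
    (weakDeriv (-1) 0 E φ).integrable.continuousOn_smul
      (BoundedContinuousFunction.continuous _).continuousOn isCompact_Icc
  rw [← h3, testPairing_apply, testPairing_apply, add_comm, ← integral_add i1 i2]
  refine integral_congr_ae ?_
  filter_upwards [contRep_spec neg_one_lt_zero φ] with θ hθ
  rw [hd, hθ]
  rfl

variable {v : ℝ → sobolev (-1) 0 E} {y : ℝ → E}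

/-- A solution `v` of the transport equation `∂ₜ v = ∂_θ v` with inflow `y(t)` at `θ = 0`, tested
against `η`: along the characteristics `θ + s = const`, the pairing of `v(s)` with the translated
test function only changes by the inflow. -/
theorem integral_shift
    (hv : ∀ t, 0 ≤ t → HasDerivWithinAt (fun s => (v s : L2 (-1) 0 E)) (weakDeriv (-1) 0 E (v t))
      (Ici 0) t)
    (hy : ContinuousOn y (Ici 0))
    (hb : ∀ t, 0 ≤ t →
      contRep neg_one_lt_zero (v t) ⟨0, right_mem_Icc.2 neg_one_lt_zero.le⟩ = y t)
    {η : ℝ → ℝ} (hη : IsTest (-1) 0 η) {t : ℝ} (ht : 0 ≤ t) :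
    ∫ θ in Icc (-1 : ℝ) 0, η θ • (v t : L2 (-1) 0 E) θ =
      (∫ θ in Icc (-1 : ℝ) 0, η (θ - t) • (v 0 : L2 (-1) 0 E) θ)
        + ∫ s in (0 : ℝ)..t, η (s - t) • y s := by
  have hd : ∀ s ∈ Icc 0 t, HasDerivWithinAt
      (fun r => testPairing E (hη.translate (r - t)) (v r : L2 (-1) 0 E)) (η (s - t) • y s)
      (Ici 0) s := by
    intro s hs
    have h2 : HasDerivWithinAt (fun r => hη.translate (r - t)) (hη.deriv.translate (s - t))
        (Ici 0) s := ((hη.hasDerivAt_translate (s - t)).comp_sub_const s t).hasDerivWithinAt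
    refine ((testPairing E).hasDerivWithinAt_of_bilinear h2 (hv s hs.1)).congr_deriv ?_
    rw [← hb s hs.1]
    exact testPairing_weakDeriv hη (v s) (sub_nonpos.2 hs.2)
  have hcη : Continuous fun s => η (s - t) :=
    hη.smooth.continuous.comp (continuous_id.sub continuous_const)
  have hcont : ContinuousOn (fun s => η (s - t) • y s) (uIcc 0 t) := by
    rw [uIcc_of_le ht]
    exact hcη.continuousOn.smul (hy.mono Icc_subset_Ici_self)
  have h := intervalIntegral.integral_eq_sub_of_hasDeriv_right_of_le ht
    (fun s hs => ((hd s hs).continuousWithinAt).mono Icc_subset_Ici_self)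
    (fun s hs => (hd s ⟨hs.1.le, hs.2.le⟩).mono fun r hr => hs.1.le.trans (mem_Ioi.1 hr).le)
    hcont.intervalIntegrable
  simp only [testPairing_apply, IsTest.translate_apply, sub_self, add_zero, zero_sub] at h
  rw [h]
  simp only [← sub_eq_add_neg, add_sub_cancel]

/-- A solution `v` of `∂ₜ v = ∂_θ v` with inflow `y(t)` at `θ = 0` is the history of `y`. -/
theorem shift_eq_history
    (hv : ∀ t, 0 ≤ t → HasDerivWithinAt (fun s => (v s : L2 (-1) 0 E)) (weakDeriv (-1) 0 E (v t))
      (Ici 0) t)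
    (hy : ContinuousOn y (Ici 0))
    (hb : ∀ t, 0 ≤ t →
      contRep neg_one_lt_zero (v t) ⟨0, right_mem_Icc.2 neg_one_lt_zero.le⟩ = y t)
    {t : ℝ} (ht : 0 ≤ t) :
    ∀ᵐ θ ∂volume.restrict (Icc (-1 : ℝ) 0),
      (v t : L2 (-1) 0 E) θ = if 0 ≤ t + θ then y (t + θ) else (v 0 : L2 (-1) 0 E) (t + θ) := by
  let W : ℝ → E := fun r => if 0 ≤ r then y r else (v 0 : L2 (-1) 0 E) r
  have hW1 : ∀ r, 0 ≤ r → W r = y r := fun r hr => if_pos hr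
  have hW2 : ∀ᵐ r, r ∈ uIoc (-1 : ℝ) 0 → W r = (v 0 : L2 (-1) 0 E) r := by
    have h0 : ∀ᵐ r : ℝ, r ≠ 0 := by simp [ae_iff, measure_singleton]
    filter_upwards [h0] with r hr hr'
    rw [uIoc_of_le neg_one_lt_zero.le] at hr'
    exact if_neg (not_le.2 (lt_of_le_of_ne hr'.2 hr))
  have hφ : IntervalIntegrable (v 0 : L2 (-1) 0 E) volume (-1) 0 :=
    (intervalIntegrable_iff_integrableOn_Icc_of_le neg_one_lt_zero.le).2 (v 0 : L2 (-1) 0 E).integrable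
  have hWi1 : IntervalIntegrable W volume (-1) 0 :=
    hφ.congr_ae ((ae_restrict_iff' measurableSet_uIoc).2
      (hW2.mono fun r h hr => (h hr).symm))
  have hWi2 : IntervalIntegrable W volume 0 t := by
    refine ContinuousOn.intervalIntegrable ?_
    rw [uIcc_of_le ht]
    exact (hy.mono Icc_subset_Ici_self).congr
      fun r hr => hW1 r hr.1
  have hWi : IntervalIntegrable W volume (-1) t := hWi1.trans hWi2
  have hWt : IntervalIntegrable W volume (t - 1) t := by
    refine hWi.mono_set ?_
    rw [uIcc_of_le (by linarith), uIcc_of_le (by linarith)]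
    exact Icc_subset_Icc_left (by linarith)
  have hw : IntegrableOn (fun θ => W (t + θ)) (Icc (-1) 0) := by
    have := hWt.comp_add_left t
    rw [sub_self, sub_sub_cancel_left] at this
    exact (intervalIntegrable_iff_integrableOn_Icc_of_le neg_one_lt_zero.le).1 this
  have hsmul : ∀ {η : ℝ → ℝ} {a b : ℝ} {k : ℝ → E}, IsTest (-1) 0 η →
      IntervalIntegrable k volume a b →
      IntervalIntegrable (fun r => η (r - t) • k r) volume a b := fun hη hk =>
    hk.continuousOn_smul
      (hη.smooth.continuous.comp (continuous_id.sub continuous_const)).continuousOn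
  have key : ∀ᵐ θ ∂volume.restrict (Icc (-1 : ℝ) 0), (v t : L2 (-1) 0 E) θ - W (t + θ) = 0 := by
    refine ae_zero_of_test ((v t : L2 (-1) 0 E).integrable.sub hw) fun η hη => ?_
    have e1 : ∫ θ in Icc (-1 : ℝ) 0, η θ • W (t + θ) = ∫ r in (t - 1)..t, η (r - t) • W r := by
      rw [integral_Icc_eq_integral_Ioc, ← intervalIntegral.integral_of_le neg_one_lt_zero.le]
      have := intervalIntegral.integral_comp_add_left (a := -1) (b := 0)
        (fun r => η (r - t) • W r) t
      simpa [sub_eq_add_neg] using this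
    -- the test function `η(· - t)` is supported in `(t - 1, t)`
    have e2 : ∫ r in (-1)..(t - 1), η (r - t) • W r = 0 := by
      rw [intervalIntegral.integral_congr (g := fun _ => (0 : E)),
        intervalIntegral.integral_zero]
      intro r hr
      rw [uIcc_of_le (by linarith)] at hr
      have : η (r - t) = 0 :=
        image_eq_zero_of_notMem_tsupport fun h => by linarith [(hη.supp h).1, hr.2]
      simp only [this, zero_smul]
    have e3 : ∫ r in (-1 : ℝ)..0, η (r - t) • W r = ∫ θ in Icc (-1 : ℝ) 0, η (θ - t) • (v 0 : L2 (-1) 0 E) θ := by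
      rw [integral_Icc_eq_integral_Ioc, ← intervalIntegral.integral_of_le neg_one_lt_zero.le]
      refine intervalIntegral.integral_congr_ae ?_
      filter_upwards [hW2] with r hr hr'
      rw [hr hr']
    have e4 : ∫ r in (0 : ℝ)..t, η (r - t) • W r = ∫ r in (0 : ℝ)..t, η (r - t) • y r := by
      refine intervalIntegral.integral_congr fun r hr => ?_
      rw [uIcc_of_le ht] at hr
      simp only [hW1 r hr.1]
    have e5 := intervalIntegral.integral_add_adjacent_intervals (a := -1) (b := t - 1) (c := t)
      (hsmul hη (hWi.mono_set (by
        rw [uIcc_of_le (by linarith), uIcc_of_le (by linarith)]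
        exact Icc_subset_Icc_right (by linarith)))) (hsmul hη hWt)
    have e6 := intervalIntegral.integral_add_adjacent_intervals (hsmul hη hWi1) (hsmul hη hWi2)
    simp only [smul_sub]
    rw [integral_sub (hη.integrable (v t : L2 (-1) 0 E).integrable) (hη.integrable hw),
      integral_shift hv hy hb hη ht, e1, sub_eq_zero, ← e3, ← e4, e6, ← e5, e2, zero_add]
  filter_upwards [key] with θ hθ using sub_eq_zero.1 hθ

end Shift

/-! ### Histories of classical solutions -/

section ClassicalSolutions

variable {n : ℕ} {d : Fin n → ℝ} {μ : Icc (-1 : ℝ) 0 → (Cn n →L[ℂ] Cn n)}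
  {hμ : BoundedVariationOn μ univ} {z₀ : State n} {z : ℝ → maxDomain n}

theorem IsClassicalSolution.isHistoryOf (hz : IsClassicalSolution d hμ z₀ z) : IsHistoryOf z₀ z := by
  intro t ht
  have hc : ContinuousOn (fun t => (z t : State n)) (Ici 0) := fun t ht =>
    (hz.evolution t ht).continuousWithinAt
  have h := shift_eq_history (v := fun s => historyPart n (z s)) (y := fun s => (z s : State n).1)
    (fun s hs => (hz.evolution s hs).hasFDerivWithinAt.snd.hasDerivWithinAt.congr_deriv
      (by simp; rfl))
    (continuous_fst.comp_continuousOn hc) (fun s hs => congrArg Prod.snd (hz.boundary s hs)) ht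
  have h0 : (historyPart n (z 0) : History n) = z₀.2 := congrArg Prod.snd hz.initial
  rw [h0] at h
  exact h

end ClassicalSolutions

/-! ### The closed-loop operator -/

section ClosedLoop

variable {n : ℕ} {d : Fin n → ℝ} {μ : Icc (-1 : ℝ) 0 → (Cn n →L[ℂ] Cn n)}

theorem mem_closedLoop_graph_iff {hμ : BoundedVariationOn μ univ} {x y : State n} :
    (x, y) ∈ (closedLoop d hμ).graph ↔
      ∃ z : maxDomain n, traceOp n z = feedbackOp hμ z ∧ (z : State n) = x ∧ maxOp d z = y := by
  rw [LinearPMap.mem_graph_iff]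
  constructor
  · rintro ⟨⟨w, hw⟩, hx, hy⟩
    obtain ⟨z, hz, rfl⟩ := hw
    exact ⟨z, hz, hx, hy⟩
  · rintro ⟨z, hz, hx, hy⟩
    exact ⟨⟨z, z, hz, rfl⟩, hx, hy⟩

theorem exists_of_mem_closedLoop_domain {hμ : BoundedVariationOn μ univ}
    (x : (closedLoop d hμ).domain) :
    ∃ z : maxDomain n, traceOp n z = feedbackOp hμ z ∧ (z : State n) = x ∧
      maxOp d z = closedLoop d hμ x :=
  mem_closedLoop_graph_iff.1 (LinearPMap.mem_graph _ x)

/-- The orbits `t ↦ T(t) z₀`, for `z₀` in the domain of the generator, are classical solutions. -/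
theorem exists_classicalSolution {hμ : BoundedVariationOn μ univ} {T : ℝ → State n →L[ℂ] State n}
    (hT : IsC0Semigroup T) (hgen : IsGenerator (closedLoop d hμ) T)
    (hderiv : ∀ x : (closedLoop d hμ).domain, ∀ t, 0 ≤ t →
      HasDerivWithinAt (fun s => T s x) (T t (closedLoop d hμ x)) (Ici 0) t)
    (x : (closedLoop d hμ).domain) :
    ∃ z : ℝ → maxDomain n, IsClassicalSolution d hμ x z := by
  have hmem : ∀ t, ∃ z : maxDomain n, 0 ≤ t → traceOp n z = feedbackOp hμ z ∧
      (z : State n) = T t x ∧ maxOp d z = T t (closedLoop d hμ x) := by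
    intro t
    by_cases ht : 0 ≤ t
    · have h1 : (T t x, T t (closedLoop d hμ x)) ∈ (closedLoop d hμ).graph := by
        rw [hgen]
        have h2 := ((T t).continuous.tendsto _).comp
          ((hgen x (closedLoop d hμ x)).1 (LinearPMap.mem_graph _ x))
        refine h2.congr' ?_
        filter_upwards [self_mem_nhdsWithin] with h (hh : 0 < h)
        have h3 : T h (T t x) = T t (T h x) := by
          have e : T h * T t = T t * T h := by
            rw [← hT.add h t hh.le ht, ← hT.add t h ht hh.le, add_comm]
          exact congrArg (fun L : State n →L[ℂ] State n => L x) e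
        rw [h3, Function.comp_apply, map_smul, map_sub]
      obtain ⟨z, hz⟩ := mem_closedLoop_graph_iff.1 h1
      exact ⟨z, fun _ => hz⟩
    · exact ⟨0, fun h => absurd h ht⟩
  choose z hz using hmem
  refine ⟨z, ?_, fun t ht => ?_, ?_, fun t ht => (hz t ht).1⟩
  · rw [(hz 0 le_rfl).2.1, hT.zero]; rfl
  · rw [(hz t ht).2.2]
    exact (hderiv x t ht).congr (fun s hs => (hz s hs).2.1) (hz t ht).2.1
  · exact (hT.continuousOn _).congr fun t ht => (hz t ht).2.2

end ClosedLoop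

end
end DelayTransport


open DelayTransport

theorem proposition5p3 (n : ℕ) (d : Fin n → ℝ) (hd : ∀ i, 0 < d i)
    (μ : Set.Icc (-1 : ℝ) 0 →
      (EuclideanSpace ℂ (Fin n) →L[ℂ] EuclideanSpace ℂ (Fin n)))
    (hμ : BoundedVariationOn μ Set.univ) :
    DelayTransport.GeneratesC0Semigroup (DelayTransport.closedLoop d hμ) ∧
      DelayTransport.IsWellPosed d hμ := by
  obtain ⟨J, κ, hJ⟩ := exists_dissipative_equiv hd hμ
  have hdiss : ∀ x : (closedLoop d hμ).domain,
      (inner ℂ (J (closedLoop d hμ x)) (J x)).re ≤ κ * ‖J (x : State n)‖ ^ 2 := by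
    intro x
    obtain ⟨z, hz, hzx, hzy⟩ := exists_of_mem_closedLoop_domain x
    rw [← hzx, ← hzy]
    exact hJ z hz
  have hsurj : ∀ c : ℝ, κ < c → ∀ y, ∃ x : (closedLoop d hμ).domain,
      (c : ℂ) • (x : State n) - closedLoop d hμ x = y := by
    intro c hc y
    obtain ⟨z, hz, hzy⟩ := exists_closedLoop_resolvent hd hμ c (fun z hz h => by
      have h1 := resolvent_estimate J (hJ z hz) c
      rw [← map_smul, ← map_sub, h, map_zero, norm_zero] at h1
      have h2 : ‖J (z : State n)‖ ≤ 0 := by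
        by_contra h3
        exact absurd h1 (not_le.2 (mul_pos (sub_pos.2 hc) (not_le.1 h3)))
      exact Subtype.ext (J.map_eq_zero_iff.1 (norm_le_zero_iff.1 h2))) y
    exact ⟨⟨z, z, hz, rfl⟩, hzy⟩
  obtain ⟨hdense, T, hT, hgen, hderiv⟩ :=
    exists_semigroup_of_dissipative J (closedLoop d hμ) κ hdiss hsurj
  refine ⟨⟨T, hT, hgen⟩, hdense, fun z₀ hz₀ => ?_, fun z₀ z w hz hw t ht => ?_, fun τ hτ => ?_⟩
  · obtain ⟨z, hz⟩ := exists_classicalSolution hT hgen hderiv ⟨z₀, hz₀⟩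
    exact ⟨z, hz, hz.isHistoryOf⟩
  · have h1 := norm_le_of_dissipative J (z := fun t => ((z t - w t : maxDomain n) : State n))
      (z' := fun t => maxOp d (z t - w t)) (κ := κ)
      (fun s hs => by
        rw [map_sub]
        exact (hz.evolution s hs).sub (hw.evolution s hs))
      (fun s hs => hJ _ (by rw [map_sub, map_sub, hz.boundary s hs, hw.boundary s hs])) ht
    have h0 : ((z 0 - w 0 : maxDomain n) : State n) = 0 := by
      rw [Submodule.coe_sub, hz.initial, hw.initial, sub_self]
    simp only [h0, map_zero, norm_zero, mul_zero] at h1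
    exact sub_eq_zero.1 (Subtype.ext (J.map_eq_zero_iff.1 (norm_le_zero_iff.1 h1)))
  · refine ⟨‖(J.symm : WithLp 2 (State n) →L[ℂ] State n)‖ *
      (Real.exp (|κ| * τ) * ‖(J : State n →L[ℂ] WithLp 2 (State n))‖), fun z₀ z hz t ht => ?_⟩
    have h1 := norm_le_of_dissipative J (z := fun t => (z t : State n))
      (z' := fun t => maxOp d (z t)) (κ := κ) hz.evolution
      (fun s hs => hJ _ (hz.boundary s hs)) ht.1
    rw [hz.initial] at h1
    have h2 : ‖(z t : State n)‖ ≤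
        ‖(J.symm : WithLp 2 (State n) →L[ℂ] State n)‖ * ‖J (z t : State n)‖ := by
      have := (J.symm : WithLp 2 (State n) →L[ℂ] State n).le_opNorm (J (z t))
      simpa using this
    have h3 : Real.exp (κ * t) ≤ Real.exp (|κ| * τ) := Real.exp_le_exp.2 <|
      mul_le_mul (le_abs_self κ) ht.2 ht.1 (abs_nonneg κ)
    have h4 := (J : State n →L[ℂ] WithLp 2 (State n)).le_opNorm z₀
    calc ‖(z t : State n)‖
        ≤ ‖(J.symm : WithLp 2 (State n) →L[ℂ] State n)‖ *
          (Real.exp (|κ| * τ) * (‖(J : State n →L[ℂ] WithLp 2 (State n))‖ * ‖z₀‖)) := by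
          refine h2.trans (mul_le_mul_of_nonneg_left (h1.trans ?_) (norm_nonneg _))
          exact mul_le_mul h3 h4 (norm_nonneg _) (Real.exp_pos _).le
      _ = _ := by ring
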